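/- Let $S$ (system) and $B$ (bath) be finite-dimensional non-zero quantum systems, $\beta=1/T>0$, and let $H_S$, $H_B$, $V$ be Hermitian operators on $S$, $B$ and $SB$. Let $\omega_\beta(H)=e^{-\beta H}/\mathrm{tr}(e^{-\beta H})$ and $F(\rho,H)=\mathrm{tr}(\rho H)+T\,\mathrm{tr}(\rho\ln\rho)$. Let $\rho_S$ be a full-rank state of $S$, let $\tilde H_S$ be a Hermitian operator with $\omega_\beta(\tilde H_S)=\rho_S$, and put $H^{(0)}=H_S+H_B$, $\tilde H^{(0)}=\tilde H_S+H_B$, $\rho^{(0)}=\rho_S\otimes\omega_\beta(H_B)$. For $g\in\mathbb R$ and Hermitian operators $X,Z$ on $S$ let $$\Delta F^{\rm (irr)}_g(X)=F(\rho^{(0)},X+H_B+gV)-F(\omega_\beta(X+H_B+gV),X+H_B+gV),$$ $$\Delta F^{\rm (res)}_g(Z)=F(\omega_\beta(Z+H_B+gV),H^{(0)})-F(\omega_\beta(H^{(0)}),H^{(0)}),$$ and let $\Delta F^{\rm (irr)}_{\min}(g)$, $\Delta F^{\rm (res)}_{\min}(g)$ be the infima of these functions over all Hermitian operators on $S$.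 A global minimiser of $\Delta F^{\rm (irr)}_g$ is called an optimal $H_S^{(1)}$, and one of $\Delta F^{\rm (res)}_g$ an optimal $H_S^{(N)}$. (Both functions are unchanged when a real multiple of $\mathbf 1$ is added to the argument.) Further let $\tilde V=V-\mathrm{tr}_B(V\omega_\beta(H_B))\otimes\mathbf 1_B$ and $$\mathrm{cov}_{\omega_\beta(H)}(A,C)=\mathrm{tr}(A_{H,\beta}\,C\,\omega_\beta(H))-\mathrm{tr}(A\,\omega_\beta(H))\,\mathrm{tr}(C\,\omega_\beta(H)),\qquad A_{H,\beta}=\int_0^1e^{\beta\tau H}Ae^{-\beta\tau H}\,d\tau .$$ Consider the cyclic protocols with one contact between $S$ and $B$, given by $N\ge 0$ and Hermitian operators $h_0,\dots,h_N$ on $S$: $H_S$ is quenched to $h_0$ in the state $\rho_S$; the coupling $gV$ is turned on in the state $\rho^{(0)}$ and the total system thermalises; for $i=0,\dots,N-1$ the system Hamiltonian is quenched from $h_i$ to $h_{i+1}$ and the total system thermalises again; finally $gV$ is turned off and $h_N$ is quenched back to $H_S$. With $\omega_i=\omega_\beta(h_i+H_B+gV)$ the extracted work is $$W=\mathrm{tr}\big((H_S-h_0-gV)\rho^{(0)}\big)+\sum_{i<N}\mathrm{tr}\big(\mathrm{tr}_B(\omega_i)(h_i-h_{i+1})\big)+\mathrm{tr}\big((gV+h_N-H_S)\omega_N\big).$$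 Let $W_{\max}(g)$ be the supremum of $W$ over all these protocols, let $W_g(X,Z)$ be the supremum over those with $h_0=X$ and $h_N=Z$, and let $W^{\rm (weak)}=F(\rho_S,H_S)-F(\omega_\beta(H_S),H_S)$. Then, as $g\to0$: 1. For all sufficiently small $|g|$ there are optimal Hamiltonians $H_S^{(1)}(g)$ and $H_S^{(N)}(g)$, which can be chosen such that $$H_S^{(1)}=\tilde H_S-g\,\mathrm{tr}_B(\omega_\beta(H_B)V)+O(g^2),\qquad H_S^{(N)}=H_S-g\,\mathrm{tr}_B(\omega_\beta(H_B)V)+O(g^2);$$ moreover every family of optimal Hamiltonians satisfies these expansions up to the addition of real multiples $c(g)\mathbf 1$ of the identity. 2. The minimal corrections are $$\Delta F^{\rm (irr)}_{\min}(g)=\frac{\beta g^2}{2}\,\mathrm{cov}_{\omega_\beta(\tilde H^{(0)})}(\tilde V,\tilde V)+O(g^3),\qquad \Delta F^{\rm (res)}_{\min}(g)=\frac{\beta g^2}{2}\,\mathrm{cov}_{\omega_\beta(H^{(0)})}(\tilde V,\tilde V)+O(g^3).$$ 3. The first-order correction to work vanishes: for every $g$ the work is bounded above over the protocols, $$W_{\max}(g)=W^{\rm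 (weak)}-\frac{\beta g^2}{2}\Big(\mathrm{cov}_{\omega_\beta(\tilde H^{(0)})}(\tilde V,\tilde V)+\mathrm{cov}_{\omega_\beta(H^{(0)})}(\tilde V,\tilde V)\Big)+O(g^3),$$ and $W_g(X(g),Z(g))=W^{\rm (weak)}+O(g^2)$ for all families of Hermitian operators $X(g)=\tilde H_S+O(g)$ and $Z(g)=H_S+O(g)$. -/

import Mathlib

open scoped Kronecker Topology ComplexOrder Matrix.Norms.L2Operator

noncomputable section

namespace StrongCoupling

variable {S B n : Type*} [Fintype S] [DecidableEq S] [Fintype B] [DecidableEq B]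
  [Fintype n] [DecidableEq n]

/-- The thermal state `ω_β(H) = exp(-β H) / tr(exp(-β H))`. -/
def gibbs (β : ℝ) (H : Matrix n n ℂ) : Matrix n n ℂ :=
  (NormedSpace.exp (-β • H)).trace⁻¹ • NormedSpace.exp (-β • H)

/-- The non-equilibrium free energy `F(ρ, H) = tr(ρ H) + T tr(ρ log ρ)` with `T = 1 / β`; the
logarithm is taken in the functional calculus of Hermitian matrices. -/
def freeEnergy (β : ℝ) (ρ H : Matrix n n ℂ) : ℝ :=
  (ρ * H).trace.re + β⁻¹ * (ρ * cfc Real.log ρ).trace.re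

/-- The averaged operator `Y_{H,β} = ∫₀¹ exp(β τ H) Y exp(-β τ H) dτ`. -/
def thermalAverage (β : ℝ) (H Y : Matrix n n ℂ) : Matrix n n ℂ :=
  ∫ τ in (0 : ℝ)..1, NormedSpace.exp ((β * τ) • H) * Y * NormedSpace.exp (-(β * τ) • H)

/-- The generalised (Kubo-Mori) covariance
`cov_{ω_β(H)}(A, C) = tr(A_{H,β} C ω_β(H)) - tr(A ω_β(H)) tr(C ω_β(H))`. -/
def cov (β : ℝ) (H A C : Matrix n n ℂ) : ℂ :=
  (thermalAverage β H A * C * gibbs β H).trace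
    - (A * gibbs β H).trace * (C * gibbs β H).trace

/-- The partial trace over the bath. -/
def traceB (M : Matrix (S × B) (S × B) ℂ) : Matrix S S ℂ :=
  Matrix.of fun i j => ∑ b, M (i, b) (j, b)

/-- An operator of the system, acting on system and bath. -/
def onS (B : Type*) [DecidableEq B] (A : Matrix S S ℂ) : Matrix (S × B) (S × B) ℂ :=
  A ⊗ₖ (1 : Matrix B B ℂ)

/-- An operator of the bath, acting on system and bath. -/
def onB (S : Type*) [DecidableEq S] (A : Matrix B B ℂ) : Matrix (S × B) (S × B) ℂ :=
  (1 : Matrix S S ℂ) ⊗ₖ A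

/-- The uncoupled Hamiltonian `X + H_B`. -/
def freeHam (HB : Matrix B B ℂ) (X : Matrix S S ℂ) : Matrix (S × B) (S × B) ℂ :=
  onS B X + onB S HB

/-- The coupled Hamiltonian `X + H_B + V`. -/
def coupledHam (HB : Matrix B B ℂ) (V : Matrix (S × B) (S × B) ℂ) (X : Matrix S S ℂ) :
    Matrix (S × B) (S × B) ℂ :=
  freeHam HB X + V

/-- The initial state `ρ_S ⊗ ω_β(H_B)`. -/
def initialState (β : ℝ) (ρS : Matrix S S ℂ) (HB : Matrix B B ℂ) :
    Matrix (S × B) (S × B) ℂ :=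
  ρS ⊗ₖ gibbs β HB

/-- The mean force of the bath on the system, `tr_B(ω_β(H_B) V)`. -/
def meanCoupling (β : ℝ) (HB : Matrix B B ℂ) (V : Matrix (S × B) (S × B) ℂ) : Matrix S S ℂ :=
  traceB (onB S (gibbs β HB) * V)

/-- The dressed interaction `Ṽ = V - tr_B(V ω_β(H_B))`. -/
def dressed (β : ℝ) (HB : Matrix B B ℂ) (V : Matrix (S × B) (S × B) ℂ) :
    Matrix (S × B) (S × B) ℂ :=
  V - onS B (traceB (V * onB S (gibbs β HB)))

/-- `ΔF^irr = F(ρ⁽⁰⁾, H⁽¹⁾) - F(ω_β(H⁽¹⁾), H⁽¹⁾)`, where `H⁽¹⁾ = X + H_B + V`. -/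
def deltaFIrr (β : ℝ) (ρS : Matrix S S ℂ) (HB : Matrix B B ℂ) (V : Matrix (S × B) (S × B) ℂ)
    (X : Matrix S S ℂ) : ℝ :=
  freeEnergy β (initialState β ρS HB) (coupledHam HB V X)
    - freeEnergy β (gibbs β (coupledHam HB V X)) (coupledHam HB V X)

/-- `ΔF^res = F(ω_β(H⁽ᴺ⁾), H⁽⁰⁾) - F(ω_β(H⁽⁰⁾), H⁽⁰⁾)`, where `H⁽⁰⁾ = H_S + H_B` and
`H⁽ᴺ⁾ = Z + H_B + V`. -/
def deltaFRes (β : ℝ) (HS : Matrix S S ℂ) (HB : Matrix B B ℂ) (V : Matrix (S × B) (S × B) ℂ)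
    (Z : Matrix S S ℂ) : ℝ :=
  freeEnergy β (gibbs β (coupledHam HB V Z)) (freeHam HB HS)
    - freeEnergy β (gibbs β (freeHam HB HS)) (freeHam HB HS)

/-- `X` is a global minimiser of `f` among the Hamiltonians of the system. -/
def IsOptimal (f : Matrix S S ℂ → ℝ) (X : Matrix S S ℂ) : Prop :=
  X.IsHermitian ∧ ∀ Y : Matrix S S ℂ, Y.IsHermitian → f X ≤ f Y

/-- The infimum of `f` over the Hamiltonians of the system; it is the minimum of `f` as soon as
some `X` satisfies `IsOptimal f X`. -/
def minValue (f : Matrix S S ℂ → ℝ) : ℝ :=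
  sInf {r | ∃ X : Matrix S S ℂ, X.IsHermitian ∧ r = f X}

/-- The work extracted in a cyclic protocol with one contact with the bath. The Hamiltonian of
the system is quenched from `H_S` to `h 0` in the state `ρ_S`, the coupling `V` is turned on in
the state `ρ_S ⊗ ω_β(H_B)`, the total system thermalises; then, for `i = 0, …, N - 1`, the system
is quenched from `h i` to `h (i + 1)` and thermalises again; finally `V` is turned off and the
system is quenched from `h N` back to `H_S`, both in the last thermal state. -/
def protocolWork (β : ℝ) (ρS HS : Matrix S S ℂ) (HB : Matrix B B ℂ)
    (V : Matrix (S × B) (S × B) ℂ) (N : ℕ) (h : ℕ → Matrix S S ℂ) : ℝ :=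
  (ρS * (HS - h 0)).trace.re - (initialState β ρS HB * V).trace.re
    + ∑ i ∈ Finset.range N,
        (traceB (gibbs β (coupledHam HB V (h i))) * (h i - h (i + 1))).trace.re
    + (gibbs β (coupledHam HB V (h N)) * V).trace.re
    + (traceB (gibbs β (coupledHam HB V (h N))) * (h N - HS)).trace.re

/-- The values of the extracted work over all one-contact protocols. -/
def workSet (β : ℝ) (ρS HS : Matrix S S ℂ) (HB : Matrix B B ℂ)
    (V : Matrix (S × B) (S × B) ℂ) : Set ℝ :=
  {w | ∃ (N : ℕ) (h : ℕ → Matrix S S ℂ), (∀ i, (h i).IsHermitian) ∧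
    w = protocolWork β ρS HS HB V N h}

/-- The maximal work, i.e. the supremum over all one-contact protocols. -/
def maxWork (β : ℝ) (ρS HS : Matrix S S ℂ) (HB : Matrix B B ℂ)
    (V : Matrix (S × B) (S × B) ℂ) : ℝ :=
  sSup (workSet β ρS HS HB V)

/-- The maximal work over the one-contact protocols in which the coupling is turned on at the
Hamiltonian `X` of the system and turned off at `Z`. -/
def contactWork (β : ℝ) (ρS HS : Matrix S S ℂ) (HB : Matrix B B ℂ)
    (V : Matrix (S × B) (S × B) ℂ) (X Z : Matrix S S ℂ) : ℝ :=
  sSup {w | ∃ (N : ℕ) (h : ℕ → Matrix S S ℂ), (∀ i, (h i).IsHermitian) ∧ h 0 = X ∧ h N = Z ∧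
    w = protocolWork β ρS HS HB V N h}

/-- The maximal work at weak coupling, `W^weak = F(ρ_S, H_S) - F(ω_β(H_S), H_S)`. -/
def weakWork (β : ℝ) (ρS HS : Matrix S S ℂ) : ℝ :=
  freeEnergy β ρS HS - freeEnergy β (gibbs β HS) HS

end StrongCoupling

end

/-! Both losses are relative entropies of Gibbs states times the temperature, i.e. values of
`gibbsDivergence`, whose arguments are an uncoupled Hamiltonian `K` and `K + E` with `E = (X - H) ⊗
1 + g V`. The irreversible loss perturbs the second argument (`H` is the Hamiltonian of which the
initial state is the Gibbs state), the residual loss the first (`H` is `H_S`). In either slot the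
expansion at `E = 0` starts with half the Kubo-Mori form `-tr(dω_β(K)[E] E)`, which is `β` times the
covariance; this is why one argument, packaged in `IsEnergyLoss`, serves both. With `M` the mean
coupling, `E = (X - H + g M) ⊗ 1 + g Ṽ`. The Gibbs state of `K` is a product, and changing the
system Hamiltonian moves only its system factor, while `tr_B(ω_β(H_B) Ṽ) = 0`. Hence `Ṽ` is
Kubo-Mori orthogonal to all system operators (`kuboMori_onS_dressed`): the quadratic part is least
at `X = H - g M`, with value `β g² / 2` times the covariance of `Ṽ`. Two points make this rigorous.
A cubic bound on the remainder would locate minimisers only to order `|g|^(3/2)`; `QuadraticApprox`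
instead bounds differences of the remainder, which yields order `g²`. And minimisers are global: the
divergence is monotone along rays from `E = 0`, so distant Hamiltonians cannot compete
(`exists_growth`, `exists_perturbed_minimum`). Multiples of the identity, on which the form
degenerates, are removed by working with traceless Hermitian matrices. For the work, partition
functions telescope: it equals the weak-coupling value minus one divergence per step
(`protocolWork_eq`). Divergences are nonnegative, and splitting a segment into many equal quenches
makes the intermediate ones negligible, so only the losses at the two ends remain. -/

set_option linter.unusedSectionVars false

noncomputable section

namespace StrongCoupling

open NormedSpace Set Filter

/-! ### Duhamel's formula and the derivative of the exponential -/

section Exponential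

variable {𝔸 : Type*} [NormedRing 𝔸] [NormedAlgebra ℝ 𝔸] [CompleteSpace 𝔸]

/-- Duhamel's formula. -/
theorem exp_add_sub_exp (A B : 𝔸) :
    exp (A + B) - exp A = ∫ s in (0 : ℝ)..1, exp (s • (A + B)) * B * exp ((1 - s) • A) := by
  let : NormedAlgebra ℚ 𝔸 := NormedAlgebra.restrictScalars ℚ ℝ 𝔸
  have hd : ∀ s : ℝ, HasDerivAt (fun s : ℝ => exp (s • (A + B)) * exp ((1 - s) • A))
      (exp (s • (A + B)) * B * exp ((1 - s) • A)) s := by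
    intro s
    have h1 := hasDerivAt_exp_smul_const (𝕂 := ℝ) (A + B) s
    have h2 : HasDerivAt (fun s : ℝ => exp ((1 - s) • A)) (-(A * exp ((1 - s) • A))) s := by
      have h := HasDerivAt.scomp s (hasDerivAt_exp_smul_const' (𝕂 := ℝ) A (1 - s))
        ((hasDerivAt_id s).const_sub 1)
      simpa [Function.comp_def] using h
    refine (h1.mul h2).congr_deriv ?_
    noncomm_ring
  have hc : Continuous fun s : ℝ => exp (s • (A + B)) * B * exp ((1 - s) • A) := by
    have he : Continuous (exp : 𝔸 → 𝔸) := exp_continuous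
    fun_prop
  have := intervalIntegral.integral_eq_sub_of_hasDerivAt (fun s _ => hd s)
    (hc.intervalIntegrable 0 1)
  rw [this]
  simp

/-- The derivative of the exponential at `A` in direction `E`. -/
def expDeriv (A E : 𝔸) : 𝔸 :=
  ∫ s in (0 : ℝ)..1, exp (s • A) * E * exp ((1 - s) • A)

/-- Duhamel's formula for `t • E`, divided by `t`, is an integral depending continuously on `t`; its
value at `t = 0` is the derivative. -/
theorem hasDerivAt_exp_add_smul (A E : 𝔸) :
    HasDerivAt (fun t : ℝ => exp (A + t • E)) (expDeriv A E) 0 := by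
  let : NormedAlgebra ℚ 𝔸 := NormedAlgebra.restrictScalars ℚ ℝ 𝔸
  have he : Continuous (exp : 𝔸 → 𝔸) := exp_continuous
  have hc : Continuous fun t : ℝ =>
      ∫ s in (0 : ℝ)..1, exp (s • (A + t • E)) * E * exp ((1 - s) • A) := by
    apply intervalIntegral.continuous_parametric_intervalIntegral_of_continuous'
    fun_prop
  rw [hasDerivAt_iff_tendsto_slope_zero]
  have h0 := (hc.tendsto 0).mono_left (nhdsWithin_le_nhds (s := {0}ᶜ))
  simp only [zero_smul, add_zero] at h0
  refine h0.congr' ?_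
  filter_upwards [self_mem_nhdsWithin] with t ht
  have ht' : t ≠ 0 := ht
  simp only [zero_add, zero_smul, add_zero]
  rw [exp_add_sub_exp, ← intervalIntegral.integral_smul]
  congr 1
  ext s
  rw [mul_smul_comm, smul_mul_assoc, smul_smul, inv_mul_cancel₀ ht', one_smul]

theorem contDiff_exp {k : WithTop ℕ∞} : ContDiff ℝ k (exp : 𝔸 → 𝔸) :=
  contDiff_iff_contDiffAt.2 fun x => (exp_analytic (𝕂 := ℝ) x).contDiffAt

theorem fderiv_exp_apply (A E : 𝔸) : fderiv ℝ (exp : 𝔸 → 𝔸) A E = expDeriv A E := by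
  have h1 : HasFDerivAt (exp : 𝔸 → 𝔸) (fderiv ℝ exp A) (A + (0 : ℝ) • E) := by
    simpa using ((contDiff_exp (𝔸 := 𝔸) (k := 1)).differentiable (by simp) A).hasFDerivAt
  have h2 : HasDerivAt (fun t : ℝ => A + t • E) E 0 := by
    simpa using ((hasDerivAt_id (0 : ℝ)).smul_const E).const_add A
  exact (h1.comp_hasDerivAt 0 h2).unique (hasDerivAt_exp_add_smul A E)

end Exponential

/-! ### Gibbs states, partition functions and their derivatives -/

variable {n : Type*} [Fintype n] [DecidableEq n]

/-- The trace as a continuous real-linear map. -/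
def traceCLM (n : Type*) [Fintype n] [DecidableEq n] : Matrix n n ℂ →L[ℝ] ℂ :=
  LinearMap.toContinuousLinearMap (Matrix.traceLinearMap n ℝ ℂ)

@[simp] theorem traceCLM_apply (X : Matrix n n ℂ) : traceCLM n X = X.trace := rfl

theorem isHermitian_smul {A : Matrix n n ℂ} (hA : A.IsHermitian) (c : ℝ) :
    (c • A).IsHermitian := by
  rw [Matrix.IsHermitian, Matrix.conjTranspose_smul, hA.eq]; simp

theorem isHermitian_smul_one (c : ℝ) : (c • (1 : Matrix n n ℂ)).IsHermitian :=
  isHermitian_smul Matrix.isHermitian_one c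

theorem exp_half_mul_exp_half (A : Matrix n n ℂ) (s : ℝ) :
    exp ((s / 2) • A) * exp ((s / 2) • A) = exp (s • A) := by
  rw [← Matrix.exp_add_of_commute _ _ (Commute.refl _), ← add_smul, add_halves]

/-- The exponential is the square of the invertible Hermitian matrix `exp (A / 2)`. -/
theorem posDef_exp {A : Matrix n n ℂ} (hA : A.IsHermitian) : (exp A).PosDef := by
  have h1 : ((exp (((1 : ℝ) / 2) • A)).IsHermitian) := (isHermitian_smul hA _).exp
  have h := Matrix.PosDef.conjTranspose_mul_self (exp (((1 : ℝ) / 2) • A))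
    (Matrix.mulVec_injective_of_isUnit (Matrix.isUnit_exp _))
  rwa [h1.eq, exp_half_mul_exp_half, one_smul] at h

/-- The partition function `tr exp(-β K)`. -/
def partition (β : ℝ) (K : Matrix n n ℂ) : ℂ := (exp (-β • K)).trace

/-- The logarithm of the partition function. -/
def logPartition (β : ℝ) (K : Matrix n n ℂ) : ℝ := Real.log (partition β K).re

theorem gibbs_eq (β : ℝ) (K : Matrix n n ℂ) :
    gibbs β K = (partition β K)⁻¹ • exp (-β • K) := rfl

theorem partition_pos [Nonempty n] (β : ℝ) {K : Matrix n n ℂ} (hK : K.IsHermitian) :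
    0 < partition β K :=
  (posDef_exp (isHermitian_smul hK _)).trace_pos

theorem partition_re_pos [Nonempty n] (β : ℝ) {K : Matrix n n ℂ} (hK : K.IsHermitian) :
    0 < (partition β K).re := (Complex.pos_iff.1 (partition_pos β hK)).1

theorem ofReal_partition_re [Nonempty n] (β : ℝ) {K : Matrix n n ℂ} (hK : K.IsHermitian) :
    ((partition β K).re : ℂ) = partition β K := by
  apply Complex.ext <;> simp [(Complex.pos_iff.1 (partition_pos β hK)).2]

theorem partition_ne_zero [Nonempty n] (β : ℝ) {K : Matrix n n ℂ} (hK : K.IsHermitian) :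
    partition β K ≠ 0 := (partition_pos β hK).ne'

theorem trace_gibbs [Nonempty n] (β : ℝ) {K : Matrix n n ℂ} (hK : K.IsHermitian) :
    (gibbs β K).trace = 1 := by
  rw [gibbs_eq, Matrix.trace_smul, smul_eq_mul]
  exact inv_mul_cancel₀ (partition_ne_zero β hK)

theorem gibbs_eq_ofReal_smul [Nonempty n] (β : ℝ) {K : Matrix n n ℂ} (hK : K.IsHermitian) :
    gibbs β K = ((partition β K).re⁻¹) • exp (-β • K) := by
  rw [gibbs_eq, ← ofReal_partition_re β hK, ← Complex.ofReal_inv]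
  rfl

theorem isHermitian_gibbs [Nonempty n] (β : ℝ) {K : Matrix n n ℂ} (hK : K.IsHermitian) :
    (gibbs β K).IsHermitian := by
  rw [gibbs_eq_ofReal_smul β hK]
  exact isHermitian_smul (isHermitian_smul hK _).exp _

theorem exp_add_smul_one (A : Matrix n n ℂ) (c : ℝ) :
    exp (A + c • (1 : Matrix n n ℂ)) = Real.exp c • exp A := by
  rw [Matrix.exp_add_of_commute _ _ (by simp [commute_iff_eq])]
  have : exp (c • (1 : Matrix n n ℂ)) = Real.exp c • 1 := by
    have h := algebraMap_exp_comm (𝕂 := ℝ) (𝔸 := Matrix n n ℂ) c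
    rw [Algebra.algebraMap_eq_smul_one, Algebra.algebraMap_eq_smul_one] at h
    rw [← h, Real.exp_eq_exp_ℝ]
  rw [this, mul_smul_comm, mul_one]

theorem partition_add_smul_one (β : ℝ) (K : Matrix n n ℂ) (c : ℝ) :
    partition β (K + c • (1 : Matrix n n ℂ)) = (Real.exp (-β * c) : ℂ) * partition β K := by
  rw [partition, smul_add, smul_smul, exp_add_smul_one, Matrix.trace_smul]
  rfl

theorem gibbs_add_smul_one (β : ℝ) (K : Matrix n n ℂ) (c : ℝ) :
    gibbs β (K + c • (1 : Matrix n n ℂ)) = gibbs β K := by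
  rw [gibbs_eq, partition_add_smul_one, smul_add, smul_smul, exp_add_smul_one, gibbs_eq,
    mul_inv, ← Complex.coe_smul, smul_smul, mul_right_comm,
    inv_mul_cancel₀ (by exact_mod_cast (Real.exp_pos _).ne'), one_mul]

theorem logPartition_add_smul_one [Nonempty n] (β : ℝ) {K : Matrix n n ℂ} (hK : K.IsHermitian)
    (c : ℝ) : logPartition β (K + c • (1 : Matrix n n ℂ)) = logPartition β K - β * c := by
  rw [logPartition, partition_add_smul_one, Complex.re_ofReal_mul,
    Real.log_mul (Real.exp_pos _).ne' (partition_re_pos β hK).ne', Real.log_exp, logPartition]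
  ring

theorem contDiff_exp_smul {k : WithTop ℕ∞} (β : ℝ) :
    ContDiff ℝ k fun K : Matrix n n ℂ => exp (-β • K) :=
  contDiff_exp.comp (contDiff_const_smul (-β))

theorem contDiff_partition {k : WithTop ℕ∞} (β : ℝ) :
    ContDiff ℝ k (partition β : Matrix n n ℂ → ℂ) :=
  (traceCLM n).contDiff.comp (contDiff_exp_smul β)

/-- Smoothness is claimed only at Hermitian points, where the partition function is known not to
vanish; differentiation still takes place in the space of all matrices. -/
theorem contDiffAt_gibbs [Nonempty n] {k : WithTop ℕ∞} (β : ℝ) {K : Matrix n n ℂ}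
    (hK : K.IsHermitian) : ContDiffAt ℝ k (gibbs β) K :=
  ((contDiff_partition β).contDiffAt.inv (partition_ne_zero β hK)).smul
    (contDiff_exp_smul β).contDiffAt

theorem trace_expDeriv_mul (A E D : Matrix n n ℂ) :
    (expDeriv A E * D).trace
      = ∫ s in (0 : ℝ)..1, (exp (s • A) * E * exp ((1 - s) • A) * D).trace := by
  have hc : Continuous fun s : ℝ => exp (s • A) * E * exp ((1 - s) • A) := by
    have he : Continuous (exp : Matrix n n ℂ → Matrix n n ℂ) := contDiff_exp (k := 0).continuous
    fun_prop
  have h := ((traceCLM n).comp ((ContinuousLinearMap.mul ℝ (Matrix n n ℂ)).flip D)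
    ).intervalIntegral_comp_comm (hc.intervalIntegrable (μ := MeasureTheory.volume) 0 1)
  simpa [expDeriv] using h.symm

/-- By cyclicity of the trace the Duhamel integrand is constant in `s`. -/
theorem trace_expDeriv (A E : Matrix n n ℂ) : (expDeriv A E).trace = (exp A * E).trace := by
  have h := trace_expDeriv_mul A E 1
  rw [mul_one] at h
  rw [h]
  have : ∀ s : ℝ, (exp (s • A) * E * exp ((1 - s) • A) * 1).trace = (exp A * E).trace := by
    intro s
    rw [mul_one, Matrix.trace_mul_comm, ← mul_assoc, ← Matrix.exp_add_of_commute _ _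
      (((Commute.refl A).smul_left _).smul_right _), ← add_smul]
    simp
  simp only [this, intervalIntegral.integral_const, sub_zero, one_smul]

/-- The substitution `s ↦ 1 - s` and cyclicity exchange the two directions; this is the source of
the symmetry of the Kubo-Mori form. -/
theorem trace_expDeriv_mul_comm (A E D : Matrix n n ℂ) :
    (expDeriv A E * D).trace = (expDeriv A D * E).trace := by
  rw [trace_expDeriv_mul, trace_expDeriv_mul]
  have h := intervalIntegral.integral_comp_sub_left (a := 0) (b := 1)
    (fun s : ℝ => (exp (s • A) * D * exp ((1 - s) • A) * E).trace) 1
  rw [sub_self, sub_zero] at h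
  rw [← h]
  congr 1
  ext s
  rw [sub_sub_cancel, mul_assoc, Matrix.trace_mul_comm]
  simp only [mul_assoc]

theorem hasDerivAt_comp_line {W G : Type*} [NormedAddCommGroup W] [NormedSpace ℝ W]
    [NormedAddCommGroup G] [NormedSpace ℝ G] {f : W → G} {x e : W} {t : ℝ}
    (hf : DifferentiableAt ℝ f (x + t • e)) :
    HasDerivAt (fun s : ℝ => f (x + s • e)) (fderiv ℝ f (x + t • e) e) t := by
  have h : HasDerivAt (fun s : ℝ => x + s • e) e t := by
    simpa using ((hasDerivAt_id t).smul_const e).const_add x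
  exact hf.hasFDerivAt.comp_hasDerivAt t h

theorem fderiv_exp_smul_apply (β : ℝ) (K E : Matrix n n ℂ) :
    fderiv ℝ (fun K : Matrix n n ℂ => exp (-β • K)) K E = -β • expDeriv (-β • K) E := by
  have h1 : HasFDerivAt (fun K : Matrix n n ℂ => -β • K)
      (-β • ContinuousLinearMap.id ℝ (Matrix n n ℂ)) K := (hasFDerivAt_id K).const_smul (-β)
  have h2 := (((contDiff_exp (𝔸 := Matrix n n ℂ) (k := 1)).differentiable (by simp)
    (-β • K)).hasFDerivAt).comp K h1
  have h3 : fderiv ℝ (fun K : Matrix n n ℂ => exp (-β • K)) K = _ := h2.fderiv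
  rw [h3, ContinuousLinearMap.comp_apply, smul_apply, map_smul,
    fderiv_exp_apply, ContinuousLinearMap.id_apply]

theorem hasDerivAt_exp_line (β : ℝ) (K E : Matrix n n ℂ) (t : ℝ) :
    HasDerivAt (fun t : ℝ => exp (-β • (K + t • E))) (-β • expDeriv (-β • (K + t • E)) E) t := by
  rw [← fderiv_exp_smul_apply]
  exact hasDerivAt_comp_line ((contDiff_exp_smul (k := 1) β).differentiable (by simp) _)

theorem hasDerivAt_partition_line (β : ℝ) (K E : Matrix n n ℂ) (t : ℝ) :
    HasDerivAt (fun t : ℝ => partition β (K + t • E))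
      (-β * (exp (-β • (K + t • E)) * E).trace) t := by
  have h := (traceCLM n).hasFDerivAt.comp_hasDerivAt t (hasDerivAt_exp_line β K E t)
  refine h.congr_deriv ?_
  rw [map_smul, traceCLM_apply, trace_expDeriv]
  simp

theorem trace_gibbs_mul (β : ℝ) (K E : Matrix n n ℂ) :
    (gibbs β K * E).trace = (partition β K)⁻¹ * (exp (-β • K) * E).trace := by
  rw [gibbs_eq, smul_mul_assoc, Matrix.trace_smul, smul_eq_mul]

theorem hasDerivAt_logPartition_line [Nonempty n] (β : ℝ) {K E : Matrix n n ℂ} {t : ℝ}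
    (hK : (K + t • E).IsHermitian) :
    HasDerivAt (fun t : ℝ => logPartition β (K + t • E))
      (-β * (gibbs β (K + t • E) * E).trace.re) t := by
  have h := (Complex.reCLM.hasFDerivAt.comp_hasDerivAt t
    (hasDerivAt_partition_line β K E t)).log (partition_re_pos β hK).ne'
  refine h.congr_deriv ?_
  rw [trace_gibbs_mul, ← ofReal_partition_re β hK]
  simp only [Complex.reCLM_apply, Function.comp_apply, ← Complex.ofReal_neg, ← Complex.ofReal_inv,
    Complex.re_ofReal_mul]
  field_simp

theorem fderiv_gibbs_apply [Nonempty n] (β : ℝ) {K : Matrix n n ℂ} (hK : K.IsHermitian)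
    (E : Matrix n n ℂ) :
    fderiv ℝ (gibbs β) K E = -((β / partition β K) • expDeriv (-β • K) E)
      + (β * (gibbs β K * E).trace) • gibbs β K := by
  have hZ := partition_ne_zero β hK
  have hd : DifferentiableAt ℝ (gibbs β) (K + (0 : ℝ) • E) := by
    simpa using (contDiffAt_gibbs (k := 1) β hK).differentiableAt (by simp)
  have h1 := hasDerivAt_comp_line hd
  have h2 := ((hasDerivAt_partition_line β K E 0).inv (by simpa using hZ)).smul
    (hasDerivAt_exp_line β K E 0)
  have h3 := h1.unique h2
  simp only [zero_smul, add_zero] at h3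
  rw [h3, trace_gibbs_mul, gibbs_eq, smul_smul, ← Complex.coe_smul, smul_smul, ← neg_smul]
  congr 2
  · simp [div_eq_mul_inv, mul_comm]
  · field_simp

/-! ### The Kubo-Mori form: symmetry, covariance, positivity -/

/-- The Kubo-Mori form `-tr(dω_β(K)[E] D)`, the Hessian of the free energy. -/
def kuboMori (β : ℝ) (K E D : Matrix n n ℂ) : ℝ :=
  -(fderiv ℝ (gibbs β) K E * D).trace.re

theorem differentiableAt_gibbs [Nonempty n] (β : ℝ) {K : Matrix n n ℂ} (hK : K.IsHermitian) :
    DifferentiableAt ℝ (gibbs β) K :=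
  (contDiffAt_gibbs (k := 1) β hK).differentiableAt (by simp)

theorem fderiv_gibbs_one [Nonempty n] (β : ℝ) {K : Matrix n n ℂ} (hK : K.IsHermitian) :
    fderiv ℝ (gibbs β) K 1 = 0 := by
  have hd : DifferentiableAt ℝ (gibbs β) (K + (0 : ℝ) • (1 : Matrix n n ℂ)) := by
    simpa using differentiableAt_gibbs β hK
  have h := hasDerivAt_comp_line hd
  simp only [gibbs_add_smul_one, zero_smul, add_zero] at h
  exact h.unique (hasDerivAt_const _ _)

theorem kuboMori_eq [Nonempty n] (β : ℝ) {K : Matrix n n ℂ} (hK : K.IsHermitian)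
    (E D : Matrix n n ℂ) :
    kuboMori β K E D = (β / partition β K * (expDeriv (-β • K) E * D).trace
      - β * (gibbs β K * E).trace * (gibbs β K * D).trace).re := by
  rw [kuboMori, fderiv_gibbs_apply β hK, add_mul, neg_mul, smul_mul_assoc, smul_mul_assoc,
    Matrix.trace_add, Matrix.trace_neg, Matrix.trace_smul, Matrix.trace_smul, ← Complex.neg_re,
    smul_eq_mul, smul_eq_mul]
  congr 1
  ring

theorem kuboMori_comm [Nonempty n] (β : ℝ) {K : Matrix n n ℂ} (hK : K.IsHermitian)
    (E D : Matrix n n ℂ) : kuboMori β K E D = kuboMori β K D E := by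
  rw [kuboMori_eq β hK, kuboMori_eq β hK, trace_expDeriv_mul_comm]
  congr 1
  ring

theorem kuboMori_add_smul_one [Nonempty n] (β : ℝ) {K : Matrix n n ℂ} (hK : K.IsHermitian)
    (E D : Matrix n n ℂ) (c d : ℝ) :
    kuboMori β K (E + c • (1 : Matrix n n ℂ)) (D + d • (1 : Matrix n n ℂ)) = kuboMori β K E D := by
  have h : ∀ E D : Matrix n n ℂ, ∀ c : ℝ,
      kuboMori β K (E + c • (1 : Matrix n n ℂ)) D = kuboMori β K E D := by
    intro E D c
    rw [kuboMori, map_add, map_smul, fderiv_gibbs_one β hK, smul_zero, add_zero, kuboMori]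
  rw [h, kuboMori_comm β hK, h, kuboMori_comm β hK]

/-- Cyclicity merges `exp (-β K)` with the left exponential of the average, and `s = 1 - τ` turns
the result into the Duhamel integrand. -/
theorem trace_thermalAverage_mul (β : ℝ) (K E D : Matrix n n ℂ) :
    (thermalAverage β K E * D * exp (-β • K)).trace = (expDeriv (-β • K) E * D).trace := by
  have hc : Continuous fun τ : ℝ => exp ((β * τ) • K) * E * exp (-(β * τ) • K) := by
    have he : Continuous (exp : Matrix n n ℂ → Matrix n n ℂ) := contDiff_exp (k := 0).continuous
    fun_prop
  have h := ((traceCLM n).comp ((ContinuousLinearMap.mul ℝ (Matrix n n ℂ)).flip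
    (D * exp (-β • K)))).intervalIntegral_comp_comm
      (hc.intervalIntegrable (μ := MeasureTheory.volume) 0 1)
  have h' := intervalIntegral.integral_comp_sub_left (a := 0) (b := 1)
    (fun s : ℝ => (exp (s • (-β • K)) * E * exp ((1 - s) • (-β • K)) * D).trace) 1
  rw [sub_self, sub_zero] at h'
  rw [trace_expDeriv_mul, ← h', mul_assoc]
  refine h.symm.trans ?_
  congr 1
  ext τ
  simp only [ContinuousLinearMap.comp_apply, ContinuousLinearMap.flip_apply,
    ContinuousLinearMap.mul_apply', traceCLM_apply]
  rw [← mul_assoc, Matrix.trace_mul_comm, ← mul_assoc, ← mul_assoc, ← mul_assoc,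
    ← Matrix.exp_add_of_commute _ _ (((Commute.refl K).smul_left _).smul_right _)]
  have e1 : -β • K + (β * τ) • K = (1 - τ) • (-β • K) := by module
  have e2 : -(β * τ) • K = (1 - (1 - τ)) • (-β • K) := by module
  rw [e1, e2]

theorem kuboMori_eq_cov [Nonempty n] (β : ℝ) {K : Matrix n n ℂ} (hK : K.IsHermitian)
    (E D : Matrix n n ℂ) : kuboMori β K E D = β * (cov β K E D).re := by
  rw [kuboMori_eq β hK, ← Complex.re_ofReal_mul, cov, Matrix.trace_mul_comm E,
    Matrix.trace_mul_comm D]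
  -- The third occurrence is the state next to the thermal average; the two expectation values stay
  -- folded.
  nth_rewrite 3 [gibbs_eq]
  rw [mul_smul_comm, Matrix.trace_smul, trace_thermalAverage_mul]
  congr 1
  rw [smul_eq_mul]
  ring

/-- Splitting each exponential into two halves writes the trace as `tr (X Xᴴ)`, and `X = 0` forces
`E = 0` because exponentials are invertible. -/
theorem trace_exp_conj_nonneg {A E : Matrix n n ℂ} (hA : A.IsHermitian) (hE : E.IsHermitian)
    (s : ℝ) : 0 ≤ (exp (s • A) * E * exp ((1 - s) • A) * E).trace.re ∧
      (E ≠ 0 → 0 < (exp (s • A) * E * exp ((1 - s) • A) * E).trace.re) := by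
  set X := exp ((s / 2) • A) * E * exp (((1 - s) / 2) • A) with hX
  have h1 : (X * X.conjTranspose).trace = (exp (s • A) * E * exp ((1 - s) • A) * E).trace := by
    rw [hX, Matrix.conjTranspose_mul, Matrix.conjTranspose_mul, hE.eq,
      (isHermitian_smul hA _).exp.eq, (isHermitian_smul hA _).exp.eq, ← mul_assoc, ← mul_assoc,
      Matrix.trace_mul_comm, ← exp_half_mul_exp_half A s, ← exp_half_mul_exp_half A (1 - s)]
    simp only [mul_assoc]
  have h2 := (Matrix.posSemidef_self_mul_conjTranspose X).trace_nonneg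
  rw [← h1]
  refine ⟨(Complex.nonneg_iff.1 h2).1, fun hne => ?_⟩
  have h3 : (X * X.conjTranspose).trace ≠ 0 := by
    rw [Ne, Matrix.trace_mul_conjTranspose_self_eq_zero_iff]
    intro h0
    apply hne
    have h5 := (Matrix.isUnit_exp ((s / 2) • A)).mul_right_eq_zero.1
      ((Matrix.isUnit_exp (((1 - s) / 2) • A)).mul_left_eq_zero.1 h0)
    exact h5
  exact (Complex.pos_iff.1 (lt_of_le_of_ne h2 h3.symm)).1

theorem trace_mul_eq_ofReal_re {A B : Matrix n n ℂ} (hA : A.IsHermitian) (hB : B.IsHermitian) :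
    (A * B).trace = (A * B).trace.re := by
  have h : (starRingEnd ℂ) (A * B).trace = (A * B).trace := by
    have h := Matrix.trace_conjTranspose (A * B)
    rw [Matrix.conjTranspose_mul, hA.eq, hB.eq, Matrix.trace_mul_comm] at h
    exact h.symm
  exact (Complex.conj_eq_iff_re.1 h).symm

theorem kuboMori_self [Nonempty n] {β : ℝ} (hβ : 0 < β) {K E : Matrix n n ℂ}
    (hK : K.IsHermitian) (hE : E.IsHermitian) :
    0 ≤ kuboMori β K E E ∧ (E.trace = 0 → E ≠ 0 → 0 < kuboMori β K E E) := by
  -- Shifting `E` to mean zero leaves the form unchanged and kills the product of expectations, so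
  -- that only an integral of nonnegative traces remains.
  set c : ℝ := -(gibbs β K * E).trace.re with hc
  set E' := E + c • (1 : Matrix n n ℂ) with hE'
  have hE'h : E'.IsHermitian := hE.add (isHermitian_smul_one c)
  have h0 : (gibbs β K * E').trace = 0 := by
    rw [hE', mul_add, Matrix.trace_add, mul_smul_comm, mul_one, Matrix.trace_smul,
      trace_gibbs β hK, trace_mul_eq_ofReal_re (isHermitian_gibbs β hK) hE]
    simp [hc]
  have hA := isHermitian_smul hK (-β)
  have hcont : Continuous fun s : ℝ =>
      (exp (s • (-β • K)) * E' * exp ((1 - s) • (-β • K)) * E').trace := by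
    have he : Continuous (exp : Matrix n n ℂ → Matrix n n ℂ) := contDiff_exp (k := 0).continuous
    exact (traceCLM n).continuous.comp (by fun_prop)
  have h1 : kuboMori β K E E = β / (partition β K).re *
      ∫ s in (0 : ℝ)..1,
        (exp (s • (-β • K)) * E' * exp ((1 - s) • (-β • K)) * E').trace.re := by
    rw [← kuboMori_add_smul_one β hK E E c c, ← hE', kuboMori_eq β hK, h0, mul_zero, sub_zero,
      trace_expDeriv_mul, ← ofReal_partition_re β hK, ← Complex.ofReal_div,
      Complex.re_ofReal_mul]
    congr 1
    exact (Complex.reCLM.intervalIntegral_comp_comm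
      (hcont.intervalIntegrable (μ := MeasureTheory.volume) 0 1)).symm
  have h2 : 0 < β / (partition β K).re := div_pos hβ (partition_re_pos β hK)
  rw [h1]
  constructor
  · exact mul_nonneg h2.le (intervalIntegral.integral_nonneg zero_le_one
      fun s _ => (trace_exp_conj_nonneg hA hE'h s).1)
  · intro htr hne
    refine mul_pos h2 (intervalIntegral.intervalIntegral_pos_of_pos
      ((Complex.continuous_re.comp hcont).intervalIntegrable 0 1)
      (fun s => (trace_exp_conj_nonneg hA hE'h s).2 ?_) zero_lt_one)
    -- If the shifted `E'` were zero, `E` would be a multiple of the identity, which for vanishing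
    -- trace means `E = 0`.
    intro hz
    have h3 : E'.trace = c * Fintype.card n := by
      rw [hE', Matrix.trace_add, htr, Matrix.trace_smul, Matrix.trace_one]
      simp
    rw [hz, Matrix.trace_zero] at h3
    have h4 : c = 0 := by
      have := h3.symm
      simpa using this
    apply hne
    rw [hE', h4, zero_smul, add_zero] at hz
    exact hz

/-- The derivative of a `C²` map is Lipschitz near `x`; the mean value inequality on the ball of
radius `‖y‖` then gives the second bound. -/
theorem exists_taylor_bound {W G : Type*} [NormedAddCommGroup W] [NormedSpace ℝ W]
    [NormedAddCommGroup G] [NormedSpace ℝ G] {f : W → G} {x : W} (hf : ContDiffAt ℝ 2 f x) :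
    ∃ C r : ℝ, 0 ≤ C ∧ 0 < r ∧ ∀ y, ‖y‖ ≤ r →
      ‖fderiv ℝ f (x + y) - fderiv ℝ f x‖ ≤ C * ‖y‖ ∧
      ‖f (x + y) - f x - fderiv ℝ f x y‖ ≤ C * ‖y‖ ^ 2 := by
  obtain ⟨C, t, ht, hC⟩ := (hf.fderiv_right (m := 1) (by norm_num)).exists_lipschitzOnWith
  have hd : ∀ᶠ y in 𝓝 x, DifferentiableAt ℝ f y :=
    (hf.eventually (by simp)).mono fun y hy => hy.differentiableAt (by simp)
  obtain ⟨r, hr, hball⟩ := Metric.nhds_basis_closedBall.mem_iff.1 (inter_mem ht hd)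
  have hxt : x ∈ t := mem_of_mem_nhds ht
  have hmem : ∀ z : W, ‖z‖ ≤ r → x + z ∈ t ∧ DifferentiableAt ℝ f (x + z) := fun z hz =>
    hball (by simpa using hz)
  have h1 : ∀ z, ‖z‖ ≤ r → ‖fderiv ℝ f (x + z) - fderiv ℝ f x‖ ≤ C * ‖z‖ := by
    intro z hz
    simpa using hC.norm_sub_le (hmem z hz).1 hxt
  refine ⟨C, r, C.2, hr, fun y hy => ⟨h1 y hy, ?_⟩⟩
  have h2 := (convex_closedBall x ‖y‖).norm_image_sub_le_of_norm_hasFDerivWithin_le'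
    (f := f) (f' := fderiv ℝ f) (φ := fderiv ℝ f x) (C := C * ‖y‖) (x := x) (y := x + y)
    (fun z hz => ?_) (fun z hz => ?_) (by simp) (by simp)
  · simpa [sq, mul_assoc] using h2
  · have hz' : ‖z - x‖ ≤ ‖y‖ := by simpa [dist_eq_norm] using hz
    have := (hmem (z - x) (hz'.trans hy)).2
    rw [add_sub_cancel] at this
    exact this.hasFDerivAt.hasFDerivWithinAt
  · have hz' : ‖z - x‖ ≤ ‖y‖ := by simpa [dist_eq_norm] using hz
    have := h1 (z - x) (hz'.trans hy)
    rw [add_sub_cancel] at this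
    exact this.trans (mul_le_mul_of_nonneg_left hz' C.2)

/-! ### The divergence of Gibbs states and its monotonicity along rays -/

/-- The difference `T D(ω_β(K) ‖ ω_β(H))` of the free energies of `ω_β(K)` and `ω_β(H)` with
respect to `H`. -/
def gibbsDivergence (β : ℝ) (K H : Matrix n n ℂ) : ℝ :=
  (gibbs β K * (H - K)).trace.re - β⁻¹ * logPartition β K + β⁻¹ * logPartition β H

/-- The normalisation can be absorbed into the exponent, making the Gibbs state the exponential of a
Hermitian matrix. -/
theorem cfc_log_gibbs [Nonempty n] (β : ℝ) {K : Matrix n n ℂ} (hK : K.IsHermitian) :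
    cfc Real.log (gibbs β K) = -β • K + (-logPartition β K) • (1 : Matrix n n ℂ) := by
  have h : gibbs β K = exp (-β • K + (-logPartition β K) • (1 : Matrix n n ℂ)) := by
    rw [exp_add_smul_one, gibbs_eq_ofReal_smul β hK, Real.exp_neg, logPartition,
      Real.exp_log (partition_re_pos β hK)]
  rw [h]
  exact CFC.log_exp _ ((isHermitian_smul hK _).add (isHermitian_smul_one _))

theorem freeEnergy_gibbs [Nonempty n] {β : ℝ} (hβ : β ≠ 0) {K : Matrix n n ℂ}
    (hK : K.IsHermitian) (H : Matrix n n ℂ) :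
    freeEnergy β (gibbs β K) H
      = (gibbs β K * (H - K)).trace.re - β⁻¹ * logPartition β K := by
  rw [freeEnergy, cfc_log_gibbs β hK]
  simp only [mul_add, mul_smul_comm, mul_one, Matrix.trace_add, Matrix.trace_smul,
    trace_gibbs β hK, mul_sub, Matrix.trace_sub, Complex.add_re, Complex.sub_re,
    Complex.smul_re, Complex.one_re, smul_eq_mul]
  field_simp
  ring

theorem freeEnergy_sub_freeEnergy_gibbs [Nonempty n] {β : ℝ} (hβ : β ≠ 0)
    {K H : Matrix n n ℂ} (hK : K.IsHermitian) (hH : H.IsHermitian) :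
    freeEnergy β (gibbs β K) H - freeEnergy β (gibbs β H) H = gibbsDivergence β K H := by
  rw [freeEnergy_gibbs hβ hK, freeEnergy_gibbs hβ hH, gibbsDivergence]
  simp

theorem gibbsDivergence_self (β : ℝ) (K : Matrix n n ℂ) : gibbsDivergence β K K = 0 := by
  simp [gibbsDivergence]

theorem gibbsDivergence_add_smul_one_right [Nonempty n] {β : ℝ} (hβ : β ≠ 0)
    {K H : Matrix n n ℂ} (hK : K.IsHermitian) (hH : H.IsHermitian) (c : ℝ) :
    gibbsDivergence β K (H + c • (1 : Matrix n n ℂ)) = gibbsDivergence β K H := by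
  rw [gibbsDivergence, logPartition_add_smul_one β hH, gibbsDivergence, add_sub_right_comm,
    mul_add, Matrix.trace_add, mul_smul_comm, mul_one, Matrix.trace_smul, trace_gibbs β hK]
  simp only [Complex.add_re, Complex.smul_re, Complex.one_re, smul_eq_mul]
  field_simp
  ring

theorem gibbsDivergence_add_smul_one_left [Nonempty n] {β : ℝ} (hβ : β ≠ 0)
    {K : Matrix n n ℂ} (hK : K.IsHermitian) (H : Matrix n n ℂ) (c : ℝ) :
    gibbsDivergence β (K + c • (1 : Matrix n n ℂ)) H = gibbsDivergence β K H := by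
  rw [gibbsDivergence, logPartition_add_smul_one β hK, gibbsDivergence, gibbs_add_smul_one,
    ← sub_sub, mul_sub _ (H - K), Matrix.trace_sub, mul_smul_comm, mul_one, Matrix.trace_smul,
    trace_gibbs β hK]
  simp only [Complex.sub_re, Complex.smul_re, Complex.one_re, smul_eq_mul]
  field_simp
  ring

theorem isHermitian_line {K E : Matrix n n ℂ} (hK : K.IsHermitian) (hE : E.IsHermitian)
    (t : ℝ) : (K + t • E).IsHermitian := hK.add (isHermitian_smul hE t)

theorem hasDerivAt_re_trace_mul {f g : ℝ → Matrix n n ℂ} {f' g' : Matrix n n ℂ} {t : ℝ}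
    (hf : HasDerivAt f f' t) (hg : HasDerivAt g g' t) :
    HasDerivAt (fun t => (f t * g t).trace.re) ((f' * g t).trace.re + (f t * g').trace.re) t := by
  have h := (Complex.reCLM.comp (traceCLM n)).hasFDerivAt.comp_hasDerivAt t (hf.mul hg)
  refine h.congr_deriv ?_
  simp

theorem hasDerivAt_gibbs_line [Nonempty n] (β : ℝ) {K E : Matrix n n ℂ} (hK : K.IsHermitian)
    (hE : E.IsHermitian) (t : ℝ) :
    HasDerivAt (fun t : ℝ => gibbs β (K + t • E)) (fderiv ℝ (gibbs β) (K + t • E) E) t :=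
  hasDerivAt_comp_line (differentiableAt_gibbs β (isHermitian_line hK hE t))

theorem hasDerivAt_line {W : Type*} [NormedAddCommGroup W] [NormedSpace ℝ W] (x e : W) (t : ℝ) :
    HasDerivAt (fun t : ℝ => x + t • e) e t := by
  simpa using ((hasDerivAt_id t).smul_const e).const_add x

theorem hasDerivAt_gibbsDivergence_right [Nonempty n] {β : ℝ} (hβ : β ≠ 0)
    (K : Matrix n n ℂ) {H E : Matrix n n ℂ} (hH : H.IsHermitian) (hE : E.IsHermitian) (t : ℝ) :
    HasDerivAt (fun t : ℝ => gibbsDivergence β K (H + t • E))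
      ((gibbs β K * E).trace.re - (gibbs β (H + t • E) * E).trace.re) t := by
  have h1 := hasDerivAt_re_trace_mul (hasDerivAt_const t (gibbs β K))
    ((hasDerivAt_line H E t).sub_const K)
  have h2 := (hasDerivAt_logPartition_line β (isHermitian_line hH hE t)).const_mul β⁻¹
  refine ((h1.sub_const (β⁻¹ * logPartition β K)).add h2).congr_deriv ?_
  simp only [zero_mul, Matrix.trace_zero, Complex.zero_re, zero_add]
  field_simp
  ring

/-- The derivative of the log-partition function cancels the term from differentiating `H - K`; only
the variation of the Gibbs state survives. -/
theorem hasDerivAt_gibbsDivergence_left [Nonempty n] {β : ℝ} (hβ : β ≠ 0)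
    {K E : Matrix n n ℂ} (H : Matrix n n ℂ) (hK : K.IsHermitian) (hE : E.IsHermitian) (t : ℝ) :
    HasDerivAt (fun t : ℝ => gibbsDivergence β (K + t • E) H)
      (kuboMori β (K + t • E) E (K + t • E - H)) t := by
  have h1 := hasDerivAt_re_trace_mul (hasDerivAt_gibbs_line β hK hE t)
    ((hasDerivAt_line K E t).const_sub H)
  have h2 := (hasDerivAt_logPartition_line β (isHermitian_line hK hE t)).const_mul β⁻¹
  refine ((h1.sub h2).add_const (β⁻¹ * logPartition β H)).congr_deriv ?_
  rw [kuboMori, ← neg_sub H, mul_neg, mul_neg, Matrix.trace_neg, Matrix.trace_neg]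
  simp only [Complex.neg_re]
  field_simp
  ring

theorem kuboMori_add_left (β : ℝ) (K E E' D : Matrix n n ℂ) :
    kuboMori β K (E + E') D = kuboMori β K E D + kuboMori β K E' D := by
  simp [kuboMori, add_mul, add_comm]

theorem kuboMori_add_right (β : ℝ) (K E D D' : Matrix n n ℂ) :
    kuboMori β K E (D + D') = kuboMori β K E D + kuboMori β K E D' := by
  simp [kuboMori, mul_add, add_comm]

theorem kuboMori_smul_left (β : ℝ) (K E D : Matrix n n ℂ) (c : ℝ) :
    kuboMori β K (c • E) D = c * kuboMori β K E D := by
  simp [kuboMori]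

theorem kuboMori_smul_right (β : ℝ) (K E D : Matrix n n ℂ) (c : ℝ) :
    kuboMori β K E (c • D) = c * kuboMori β K E D := by
  simp [kuboMori]

/-- At `K + t E` the derivative is `t` times the Kubo-Mori form of `E` with itself. -/
theorem monotoneOn_gibbsDivergence_left [Nonempty n] {β : ℝ} (hβ : 0 < β)
    {K E : Matrix n n ℂ} (hK : K.IsHermitian) (hE : E.IsHermitian) :
    MonotoneOn (fun t : ℝ => gibbsDivergence β (K + t • E) K) (Ici 0) := by
  have h := hasDerivAt_gibbsDivergence_left hβ.ne' K hK hE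
  refine monotoneOn_of_deriv_nonneg (convex_Ici 0)
    (fun t _ => (h t).continuousAt.continuousWithinAt)
    (fun t _ => (h t).differentiableAt.differentiableWithinAt) fun t ht => ?_
  rw [interior_Ici] at ht
  rw [(h t).deriv, add_sub_cancel_left, kuboMori_smul_right]
  exact mul_nonneg (le_of_lt ht) (kuboMori_self hβ (isHermitian_line hK hE t) hE).1

/-- The derivative vanishes at `t = 0` and is itself nondecreasing, since its own derivative is a
Kubo-Mori square. -/
theorem monotoneOn_gibbsDivergence_right [Nonempty n] {β : ℝ} (hβ : 0 < β)
    {K E : Matrix n n ℂ} (hK : K.IsHermitian) (hE : E.IsHermitian) :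
    MonotoneOn (fun t : ℝ => gibbsDivergence β K (K + t • E)) (Ici 0) := by
  have h := hasDerivAt_gibbsDivergence_right hβ.ne' K hK hE
  have h' : ∀ t, HasDerivAt
      (fun t : ℝ => (gibbs β K * E).trace.re - (gibbs β (K + t • E) * E).trace.re)
      (kuboMori β (K + t • E) E E) t := by
    intro t
    refine ((hasDerivAt_re_trace_mul (hasDerivAt_gibbs_line β hK hE t)
      (hasDerivAt_const t E)).const_sub ((gibbs β K * E).trace.re)).congr_deriv ?_
    simp [kuboMori]
  have hm : Monotone
      (fun t : ℝ => (gibbs β K * E).trace.re - (gibbs β (K + t • E) * E).trace.re) :=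
    monotone_of_deriv_nonneg (fun t => (h' t).differentiableAt) fun t => by
      rw [(h' t).deriv]
      exact (kuboMori_self hβ (isHermitian_line hK hE t) hE).1
  refine monotoneOn_of_deriv_nonneg (convex_Ici 0)
    (fun t _ => (h t).continuousAt.continuousWithinAt)
    (fun t _ => (h t).differentiableAt.differentiableWithinAt) fun t ht => ?_
  rw [interior_Ici] at ht
  rw [(h t).deriv]
  have := hm (le_of_lt ht : (0 : ℝ) ≤ t)
  simpa using this

theorem gibbsDivergence_nonneg [Nonempty n] {β : ℝ} (hβ : 0 < β) {K H : Matrix n n ℂ}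
    (hK : K.IsHermitian) (hH : H.IsHermitian) : 0 ≤ gibbsDivergence β K H := by
  have h := monotoneOn_gibbsDivergence_right hβ hK (hH.sub hK) (mem_Ici.2 le_rfl)
    (mem_Ici.2 zero_le_one) zero_le_one
  simpa [gibbsDivergence_self] using h

theorem abs_re_trace_mul_le (A B : Matrix n n ℂ) :
    |(A * B).trace.re| ≤ ‖traceCLM n‖ * (‖A‖ * ‖B‖) :=
  (Complex.abs_re_le_norm _).trans (((traceCLM n).le_opNorm (A * B)).trans
    (mul_le_mul_of_nonneg_left (norm_mul_le A B) (norm_nonneg _)))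

theorem hasDerivAt_half_kuboMori [Nonempty n] (β : ℝ) {K : Matrix n n ℂ} (hK : K.IsHermitian)
    (E D : Matrix n n ℂ) (t : ℝ) :
    HasDerivAt (fun t : ℝ => kuboMori β K (E + t • D) (E + t • D) / 2)
      (kuboMori β K (E + t • D) D) t := by
  have h : (fun t : ℝ => kuboMori β K (E + t • D) (E + t • D) / 2) = fun t : ℝ =>
      kuboMori β K E E / 2 + t * kuboMori β K E D + t ^ 2 * (kuboMori β K D D / 2) := by
    ext t
    simp only [kuboMori_add_left, kuboMori_add_right, kuboMori_smul_left, kuboMori_smul_right,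
      kuboMori_comm β hK D E]
    ring
  rw [h]
  refine ((((hasDerivAt_id t).mul_const (kuboMori β K E D)).const_add _).add
    ((hasDerivAt_pow 2 t).mul_const (kuboMori β K D D / 2))).congr_deriv ?_
  rw [kuboMori_add_left, kuboMori_smul_left]
  simp
  ring

/-! ### Second-order expansion of the divergence -/

/-- `f` agrees with the quadratic form `q` up to a remainder which is, on small balls of radius
`s`, Lipschitz with a constant of order `s ^ 2`. -/
def QuadraticApprox {W : Type*} [NormedAddCommGroup W] (p : W → Prop) (f q : W → ℝ) : Prop :=
  ∃ C r : ℝ, 0 ≤ C ∧ 0 < r ∧ ∀ x y : W, ∀ s : ℝ, p x → p y → ‖x‖ ≤ s → ‖y‖ ≤ s → s ≤ r →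
    |(f x - q x) - (f y - q y)| ≤ C * s ^ 2 * ‖x - y‖

/-- Mean value inequality for `f - q` along the segment from `y` to `x`, which stays in the ball of
radius `s`. -/
theorem quadraticApprox_of_hasDerivAt {W : Type*} [NormedAddCommGroup W] [NormedSpace ℝ W]
    {p : W → Prop} {f q : W → ℝ} {f' q' : W → W → ℝ} {C r : ℝ} (hC : 0 ≤ C) (hr : 0 < r)
    (hp : ∀ x y, p x → p y → ∀ t : ℝ, p (y + t • (x - y)))
    (hsub : ∀ x y, p x → p y → p (x - y))
    (hf : ∀ x e, p x → p e → ∀ t : ℝ, HasDerivAt (fun t : ℝ => f (x + t • e)) (f' (x + t • e) e) t)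
    (hq : ∀ x e, p x → p e → ∀ t : ℝ, HasDerivAt (fun t : ℝ => q (x + t • e)) (q' (x + t • e) e) t)
    (hb : ∀ x e, p x → p e → ‖x‖ ≤ r → |f' x e - q' x e| ≤ C * ‖x‖ ^ 2 * ‖e‖) :
    QuadraticApprox p f q := by
  refine ⟨C, r, hC, hr, fun x y s hx hy hxs hys hsr => ?_⟩
  have hd := hsub x y hx hy
  have h := norm_image_sub_le_of_norm_deriv_le_segment_01' (C := C * s ^ 2 * ‖x - y‖)
    (fun t _ => ((hf y (x - y) hy hd t).sub (hq y (x - y) hy hd t)).hasDerivWithinAt)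
    (fun t ht => ?_)
  · simpa using h
  · have hz : ‖y + t • (x - y)‖ ≤ s := by
      have := (convex_closedBall (0 : W) s).add_smul_sub_mem (x := y) (y := x) (by simpa using hys)
        (by simpa using hxs) ⟨ht.1, ht.2.le⟩
      simpa using this
    rw [Real.norm_eq_abs]
    refine (hb _ _ (hp x y hx hy t) hd (hz.trans hsr)).trans ?_
    gcongr

theorem quadraticApprox_gibbsDivergence_right [Nonempty n] {β : ℝ} (hβ : 0 < β)
    {K : Matrix n n ℂ} (hK : K.IsHermitian) :
    QuadraticApprox Matrix.IsHermitian (fun E => gibbsDivergence β K (K + E))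
      fun E => kuboMori β K E E / 2 := by
  obtain ⟨C, r, hC, hr, h⟩ := exists_taylor_bound (contDiffAt_gibbs (k := 2) β hK)
  refine quadraticApprox_of_hasDerivAt (C := ‖traceCLM n‖ * C)
    (f' := fun E D => (gibbs β K * D).trace.re - (gibbs β (K + E) * D).trace.re)
    (q' := fun E D => kuboMori β K E D) (by positivity) hr
    (fun x y hx hy t => isHermitian_line hy (hx.sub hy) t) (fun x y hx hy => hx.sub hy)
    (fun x e hx he t => ?_) (fun x e _ _ t => hasDerivAt_half_kuboMori β hK x e t)
    (fun x e _ _ hxr => ?_)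
  · simpa only [add_assoc] using hasDerivAt_gibbsDivergence_right hβ.ne' K (hK.add hx) he t
  -- The error of the derivative is the first-order Taylor remainder of the Gibbs map, tested
  -- against `e`.
  · have h1 : (gibbs β K * e).trace.re - (gibbs β (K + x) * e).trace.re - kuboMori β K x e
        = -((gibbs β (K + x) - gibbs β K - fderiv ℝ (gibbs β) K x) * e).trace.re := by
      simp only [kuboMori, sub_mul, Matrix.trace_sub, Complex.sub_re]
      ring
    rw [h1, abs_neg]
    refine (abs_re_trace_mul_le _ _).trans ?_
    rw [mul_assoc, mul_assoc, ← mul_assoc C]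
    gcongr
    exact (h x hxr).2

theorem quadraticApprox_gibbsDivergence_left [Nonempty n] {β : ℝ} (hβ : 0 < β)
    {K : Matrix n n ℂ} (hK : K.IsHermitian) :
    QuadraticApprox Matrix.IsHermitian (fun E => gibbsDivergence β (K + E) K)
      fun E => kuboMori β K E E / 2 := by
  obtain ⟨C, r, hC, hr, h⟩ := exists_taylor_bound (contDiffAt_gibbs (k := 2) β hK)
  refine quadraticApprox_of_hasDerivAt (C := ‖traceCLM n‖ * C)
    (f' := fun E D => kuboMori β (K + E) D E)
    (q' := fun E D => kuboMori β K E D) (by positivity) hr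
    (fun x y hx hy t => isHermitian_line hy (hx.sub hy) t) (fun x y hx hy => hx.sub hy)
    (fun x e hx he t => ?_) (fun x e _ _ t => hasDerivAt_half_kuboMori β hK x e t)
    (fun x e _ _ hxr => ?_)
  · simpa only [add_assoc, add_sub_cancel_left] using
      hasDerivAt_gibbsDivergence_left hβ.ne' K (hK.add hx) he t
  -- One factor `‖x‖` comes from the Lipschitz bound on the derivative of the Gibbs map, the other
  -- from the argument `x` of the form.
  · have h1 : kuboMori β (K + x) e x - kuboMori β K x e
        = -(((fderiv ℝ (gibbs β) (K + x) - fderiv ℝ (gibbs β) K) e) * x).trace.re := by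
      rw [kuboMori_comm β hK x e]
      simp only [kuboMori, sub_mul, Matrix.trace_sub, Complex.sub_re, sub_apply]
      ring
    have h2 : ‖(fderiv ℝ (gibbs β) (K + x) - fderiv ℝ (gibbs β) K) e‖ ≤ C * ‖x‖ * ‖e‖ :=
      (ContinuousLinearMap.le_opNorm _ _).trans
        (mul_le_mul_of_nonneg_right (h x hxr).1 (norm_nonneg e))
    rw [h1, abs_neg]
    calc _ ≤ ‖traceCLM n‖ * ((C * ‖x‖ * ‖e‖) * ‖x‖) :=
          (abs_re_trace_mul_le _ _).trans (by gcongr)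
      _ = _ := by ring

theorem continuousAt_gibbsDivergence [Nonempty n] (β : ℝ) {K H : Matrix n n ℂ}
    (hK : K.IsHermitian) (hH : H.IsHermitian) :
    ContinuousAt (fun p : Matrix n n ℂ × Matrix n n ℂ => gibbsDivergence β p.1 p.2) (K, H) := by
  have hg : ContinuousAt (gibbs β) K := (differentiableAt_gibbs β hK).continuousAt
  have hl : ∀ {X : Matrix n n ℂ}, X.IsHermitian → ContinuousAt (logPartition β) X := fun hX =>
    (Complex.continuous_re.continuousAt.comp
      (contDiff_partition (k := 0) β).continuous.continuousAt).log (partition_re_pos β hX).ne'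
  have h1 : ContinuousAt (fun p : Matrix n n ℂ × Matrix n n ℂ => gibbs β p.1) (K, H) :=
    ContinuousAt.comp (f := Prod.fst) (g := gibbs β) hg continuousAt_fst
  have h2 : ContinuousAt (fun p : Matrix n n ℂ × Matrix n n ℂ => logPartition β p.1) (K, H) :=
    ContinuousAt.comp (f := Prod.fst) (g := logPartition β) (hl hK) continuousAt_fst
  have h3 : ContinuousAt (fun p : Matrix n n ℂ × Matrix n n ℂ => logPartition β p.2) (K, H) :=
    ContinuousAt.comp (f := Prod.snd) (g := logPartition β) (hl hH) continuousAt_snd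
  have h4 : ContinuousAt (fun p : Matrix n n ℂ × Matrix n n ℂ =>
      (gibbs β p.1 * (p.2 - p.1)).trace.re) (K, H) :=
    (Complex.reCLM.comp (traceCLM n)).continuous.continuousAt.comp
      (h1.mul (continuousAt_snd.sub continuousAt_fst))
  exact (h4.sub (h2.const_mul _)).add (h3.const_mul _)

/-! ### Minimisers of a nearly quadratic function on shifted subspaces -/

section PerturbedMinimum

variable {W U : Type*} [NormedAddCommGroup W] [NormedSpace ℝ W] [FiniteDimensional ℝ W]
  [NormedAddCommGroup U] [NormedSpace ℝ U] [FiniteDimensional ℝ U]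

theorem exists_coercive (B : W →ₗ[ℝ] W →ₗ[ℝ] ℝ) (hB : ∀ x, x ≠ 0 → 0 < B x x) :
    ∃ m M : ℝ, 0 < m ∧ 0 ≤ M ∧ ∀ x, m * ‖x‖ ^ 2 ≤ B x x ∧ B x x ≤ M * ‖x‖ ^ 2 := by
  have hc : Continuous fun x => B x x := by
    have h : ∀ x, B x x = LinearMap.toContinuousLinearMap
        ((LinearMap.toContinuousLinearMap : (W →ₗ[ℝ] ℝ) ≃ₗ[ℝ] _).toLinearMap ∘ₗ B) x x :=
      fun x => rfl
    simp only [h]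
    fun_prop
  rcases subsingleton_or_nontrivial W with hW | hW
  · refine ⟨1, 1, one_pos, zero_le_one, fun x => ?_⟩
    rw [Subsingleton.elim x 0]
    simp
  · have hne : (Metric.sphere (0 : W) 1).Nonempty := NormedSpace.sphere_nonempty.2 zero_le_one
    obtain ⟨a, ha, hmin⟩ := (isCompact_sphere (0 : W) 1).exists_isMinOn hne hc.continuousOn
    obtain ⟨b, hb, hmax⟩ := (isCompact_sphere (0 : W) 1).exists_isMaxOn hne hc.continuousOn
    have ha0 : a ≠ 0 := by rintro rfl; simp at ha
    have hb0 : b ≠ 0 := by rintro rfl; simp at hb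
    refine ⟨B a a, B b b, hB a ha0, (hB b hb0).le, fun x => ?_⟩
    by_cases hx : x = 0
    · simp [hx]
    · have hx' : 0 < ‖x‖ := norm_pos_iff.2 hx
      have hmem : ‖x‖⁻¹ • x ∈ Metric.sphere (0 : W) 1 := by
        simp [norm_smul, hx'.ne']
      have hs : B x x = ‖x‖ ^ 2 * B (‖x‖⁻¹ • x) (‖x‖⁻¹ • x) := by
        simp only [map_smul, LinearMap.smul_apply, smul_eq_mul]
        field_simp
      rw [hs, mul_comm _ (‖x‖ ^ 2), mul_comm _ (‖x‖ ^ 2)]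
      exact ⟨mul_le_mul_of_nonneg_left (isMinOn_iff.1 hmin _ hmem) (by positivity),
        mul_le_mul_of_nonneg_left (isMaxOn_iff.1 hmax _ hmem) (by positivity)⟩

/-- A function which is monotone along the rays from `0` and close to a positive definite
quadratic form near `0` grows quadratically near `0` and is bounded below away from `0`. -/
theorem exists_growth {f : W → ℝ} {B : W →ₗ[ℝ] W →ₗ[ℝ] ℝ} (hB : ∀ x, x ≠ 0 → 0 < B x x)
    (hf0 : f 0 = 0) (hmono : ∀ x, MonotoneOn (fun t : ℝ => f (t • x)) (Ici 0))
    (happ : QuadraticApprox (fun _ => True) f fun x => B x x) :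
    ∃ k r : ℝ, 0 < k ∧ 0 < r ∧ ∀ x c, f x ≤ c → c < k * r ^ 2 → k * ‖x‖ ^ 2 ≤ c ∧ ‖x‖ ≤ r := by
  obtain ⟨m, M, hm, hM, hmM⟩ := exists_coercive B hB
  obtain ⟨C, r, hC, hr, h⟩ := happ
  -- On this radius the cubic remainder is at most half of the coercive term `m ‖x‖²`.
  set r₁ := min r (m / (2 * (C + 1))) with hr₁
  have hr₁0 : 0 < r₁ := lt_min hr (by positivity)
  have hloc : ∀ x, ‖x‖ ≤ r₁ → m / 2 * ‖x‖ ^ 2 ≤ f x := by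
    intro x hx
    have h1 := h x 0 ‖x‖ trivial trivial le_rfl (by simp) (hx.trans (min_le_left _ _))
    simp only [hf0, map_zero, sub_zero] at h1
    have h2 : C * ‖x‖ ≤ m / 2 := by
      have h3 : ‖x‖ ≤ m / (2 * (C + 1)) := hx.trans (min_le_right _ _)
      rw [le_div_iff₀ (by positivity)] at h3
      nlinarith [norm_nonneg x]
    have h4 := (abs_le.1 h1).1
    have h5 := (hmM x).1
    have h6 : C * ‖x‖ ^ 2 * ‖x‖ ≤ m / 2 * ‖x‖ ^ 2 := by
      calc C * ‖x‖ ^ 2 * ‖x‖ = (C * ‖x‖) * ‖x‖ ^ 2 := by ring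
        _ ≤ _ := by gcongr
    linarith
  refine ⟨m / 2, r₁, by positivity, hr₁0, fun x c hxc hc => ?_⟩
  -- A point outside is pulled back along its ray to the sphere of radius `r₁`, where `f` is already
  -- at least `k r₁²`.
  have hle : ‖x‖ ≤ r₁ := by
    by_contra hlt
    push Not at hlt
    have hx0 : 0 < ‖x‖ := hr₁0.trans hlt
    have h1 : ‖(r₁ / ‖x‖) • x‖ = r₁ := by
      rw [norm_smul, Real.norm_of_nonneg (by positivity)]
      field_simp
    have h2 := hloc _ h1.le
    rw [h1] at h2
    have h3 := hmono x (mem_Ici.2 (by positivity : (0 : ℝ) ≤ r₁ / ‖x‖))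
      (mem_Ici.2 zero_le_one) ((div_le_one hx0).2 hlt.le)
    simp only [one_smul] at h3
    linarith
  exact ⟨(hloc x hle).trans hxc, hle⟩

/-- First-order location of the minimisers of `f` on the affine subspaces `ι U + g v`. -/
theorem exists_perturbed_minimum {f : W → ℝ} {B : W →ₗ[ℝ] W →ₗ[ℝ] ℝ}
    (hB : ∀ x, x ≠ 0 → 0 < B x x) (hf : Continuous f)
    (hf0 : f 0 = 0) (hmono : ∀ x, MonotoneOn (fun t : ℝ => f (t • x)) (Ici 0))
    (happ : QuadraticApprox (fun _ => True) f fun x => B x x)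
    {ι : U →ₗ[ℝ] W} (hι : Function.Injective ι) {v : W}
    (horth : ∀ u, B (ι u) v = 0 ∧ B v (ι u) = 0) :
    ∃ δ C : ℝ, 0 < δ ∧ ∀ g : ℝ, |g| < δ →
      (∃ u, ∀ u', f (ι u + g • v) ≤ f (ι u' + g • v)) ∧
      ∀ u, (∀ u', f (ι u + g • v) ≤ f (ι u' + g • v)) →
        ‖u‖ ≤ C * g ^ 2 ∧ |f (ι u + g • v) - g ^ 2 * B v v| ≤ C * |g| ^ 3 := by
  obtain ⟨m, M, hm, hM, hmM⟩ := exists_coercive B hB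
  obtain ⟨k, r₁, hk, hr₁, hgrow⟩ := exists_growth hB hf0 hmono happ
  obtain ⟨C, r, hC, hr, h⟩ := happ
  obtain ⟨κ, hκ, hanti⟩ := ι.exists_antilipschitzWith (LinearMap.ker_eq_bot.2 hι)
  have hnorm : ∀ u, ‖u‖ ≤ κ * ‖ι u‖ := fun u => by
    simpa using hanti.le_mul_dist u 0
  -- `D g²` bounds the value at the trial point `g v`. By the growth estimate a competitor that is
  -- no worse has norm at most `√(D / k) |g|`, and `L` also accounts for subtracting `g v`. The two
  -- terms of `δ` keep `L |g|` within the radius of the expansion and `D g²` below the growth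
  -- threshold.
  set D := M * ‖v‖ ^ 2 + C * r * ‖v‖ ^ 2 + 1 with hD
  have hD0 : 0 < D := by positivity
  set L := Real.sqrt (D / k) + ‖v‖ with hL
  have hL0 : 0 < L := by positivity
  set δ := min (r / L) (Real.sqrt (k * r₁ ^ 2 / D)) with hδ
  have hδ0 : 0 < δ := lt_min (by positivity) (by positivity)
  set A := C * L ^ 2 / m with hA
  have hA0 : 0 ≤ A := by positivity
  refine ⟨δ, max (κ * A) (M * (A * L) + C * L ^ 2 * L), hδ0, fun g hg => ?_⟩
  have hgL : L * |g| ≤ r := by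
    have := (hg.le.trans (min_le_left _ _))
    rw [le_div_iff₀ hL0] at this
    linarith
  have hgD : D * g ^ 2 < k * r₁ ^ 2 := by
    have h1 : |g| < Real.sqrt (k * r₁ ^ 2 / D) := hg.trans_le (min_le_right _ _)
    rw [Real.lt_sqrt (abs_nonneg g), sq_abs, lt_div_iff₀ hD0] at h1
    linarith
  have hv : ‖g • v‖ ≤ L * |g| := by
    rw [norm_smul, Real.norm_eq_abs, mul_comm]
    gcongr
    exact le_add_of_nonneg_left (Real.sqrt_nonneg _)
  have hfv : f (g • v) ≤ D * g ^ 2 := by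
    have hv' : ‖g • v‖ ≤ r := hv.trans hgL
    have h1 := h (g • v) 0 ‖g • v‖ trivial trivial le_rfl (by simp) hv'
    simp only [hf0, map_zero, sub_zero] at h1
    have h2 := (abs_le.1 h1).2
    have h3 := (hmM (g • v)).2
    have h4 : C * ‖g • v‖ ^ 2 * ‖g • v‖ ≤ C * ‖g • v‖ ^ 2 * r := by gcongr
    have h5 : ‖g • v‖ ^ 2 = g ^ 2 * ‖v‖ ^ 2 := by
      rw [norm_smul, mul_pow, Real.norm_eq_abs, sq_abs]
    rw [h5] at h3 h4 h2
    nlinarith [sq_nonneg g]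
  have hloc : ∀ u, f (ι u + g • v) ≤ f (g • v) → ‖ι u + g • v‖ ≤ L * |g| ∧ ‖ι u‖ ≤ L * |g| := by
    intro u hu
    have h1 := (hgrow _ _ (hu.trans hfv) hgD).1
    have h2 : ‖ι u + g • v‖ ≤ Real.sqrt (D / k) * |g| := by
      rw [← Real.sqrt_sq_eq_abs, ← Real.sqrt_mul (by positivity)]
      apply Real.le_sqrt_of_sq_le
      rw [div_mul_eq_mul_div, le_div_iff₀ hk]
      linarith
    refine ⟨h2.trans (by gcongr; exact le_add_of_nonneg_right (norm_nonneg v)), ?_⟩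
    calc ‖ι u‖ = ‖(ι u + g • v) - g • v‖ := by rw [add_sub_cancel_right]
      _ ≤ ‖ι u + g • v‖ + ‖g • v‖ := norm_sub_le _ _
      _ ≤ Real.sqrt (D / k) * |g| + ‖v‖ * |g| := by
          rw [norm_smul g, Real.norm_eq_abs, mul_comm |g|]
          gcongr
      _ = L * |g| := by rw [hL]; ring
  constructor
  · have hιc : Continuous fun u => f (ι u + g • v) :=
      hf.comp ((LinearMap.continuous_of_finiteDimensional ι).add continuous_const)
    obtain ⟨u, hu, hmin⟩ := (isCompact_closedBall (0 : U) (κ * (L * |g|))).exists_isMinOn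
      ⟨0, by simpa using by positivity⟩ hιc.continuousOn
    rw [isMinOn_iff] at hmin
    have h0 : f (ι u + g • v) ≤ f (g • v) := by
      simpa using hmin 0 (by simpa using by positivity)
    refine ⟨u, fun u' => ?_⟩
    by_cases hu' : f (ι u' + g • v) ≤ f (g • v)
    · apply hmin
      simpa using (hnorm u').trans (by gcongr; exact (hloc u' hu').2)
    · exact h0.trans (not_le.1 hu').le
  · intro u hu
    have h0 : f (ι u + g • v) ≤ f (g • v) := by simpa using hu 0
    obtain ⟨h1, h2⟩ := hloc u h0
    -- Orthogonality removes the cross terms.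
    have hBe : B (ι u + g • v) (ι u + g • v) = B (ι u) (ι u) + g ^ 2 * B v v := by
      simp only [map_add, map_smul, LinearMap.add_apply, LinearMap.smul_apply, smul_eq_mul,
        (horth u).1, (horth u).2]
      ring
    have hBv : B (g • v) (g • v) = g ^ 2 * B v v := by
      simp only [map_smul, LinearMap.smul_apply, smul_eq_mul]
      ring
    -- The points compared differ by `ι u`, so the remainder changes by at most `C (L |g|)² ‖ι u‖`.
    -- Since the minimiser is no worse than `g v`, this dominates `m ‖ι u‖²`, and one factor `‖ι u‖`
    -- cancels.
    have h3 := h (ι u + g • v) (g • v) (L * |g|) trivial trivial h1 hv hgL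
    beta_reduce at h3
    rw [hBe, hBv, add_sub_cancel_right] at h3
    have h4 : ‖ι u‖ ≤ A * g ^ 2 := by
      have h5 := (hmM (ι u)).1
      have h6 := (abs_le.1 h3).1
      have h7 : m * ‖ι u‖ ^ 2 ≤ C * (L * |g|) ^ 2 * ‖ι u‖ := by linarith
      rcases (norm_nonneg (ι u)).eq_or_lt with h8 | h8
      · rw [← h8]; positivity
      · have h9 : m * ‖ι u‖ ≤ C * (L * |g|) ^ 2 := by
          refine le_of_mul_le_mul_right ?_ h8
          linarith [h7]
        rw [mul_pow, sq_abs] at h9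
        rw [hA, div_mul_eq_mul_div, le_div_iff₀ hm]
        linarith
    constructor
    · calc ‖u‖ ≤ κ * (A * g ^ 2) := (hnorm u).trans (by gcongr)
        _ = (κ * A) * g ^ 2 := by ring
        _ ≤ _ := by gcongr; exact le_max_left _ _
    · have h5 := h (ι u + g • v) 0 (L * |g|) trivial trivial h1 (by simpa using by positivity) hgL
      simp only [hBe, hf0, map_zero, sub_zero] at h5
      have h6 : B (ι u) (ι u) ≤ M * (A * L) * |g| ^ 3 := by
        calc B (ι u) (ι u) ≤ M * ‖ι u‖ ^ 2 := (hmM _).2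
          _ = M * (‖ι u‖ * ‖ι u‖) := by ring
          _ ≤ M * ((A * g ^ 2) * (L * |g|)) := by gcongr
          _ = M * (A * L) * |g| ^ 3 := by rw [← sq_abs g]; ring
      have h6' : 0 ≤ B (ι u) (ι u) := le_trans (by positivity) (hmM (ι u)).1
      have h7 : C * (L * |g|) ^ 2 * ‖ι u + g • v‖ ≤ C * L ^ 2 * L * |g| ^ 3 := by
        calc C * (L * |g|) ^ 2 * ‖ι u + g • v‖ ≤ C * (L * |g|) ^ 2 * (L * |g|) := by gcongr
          _ = _ := by ring
      have h8 : |f (ι u + g • v) - g ^ 2 * B v v|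
          ≤ (M * (A * L) + C * L ^ 2 * L) * |g| ^ 3 := by
        rw [abs_le] at h5 ⊢
        have : 0 ≤ M * (A * L) * |g| ^ 3 := by positivity
        constructor <;> linarith [h5.1, h5.2]
      exact h8.trans (by gcongr; exact le_max_right _ _)

end PerturbedMinimum

/-! ### System and bath: product Gibbs states and the partial trace -/

variable {S B : Type*} [Fintype S] [DecidableEq S] [Fintype B] [DecidableEq B]

/-- `onS` as a ring homomorphism. -/
def onSRingHom (S B : Type*) [Fintype S] [DecidableEq S] [Fintype B] [DecidableEq B] :
    Matrix S S ℂ →+* Matrix (S × B) (S × B) ℂ where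
  toFun := onS B
  map_one' := Matrix.one_kronecker_one
  map_mul' A C := by simp [onS, ← Matrix.mul_kronecker_mul]
  map_zero' := Matrix.zero_kronecker _
  map_add' A C := Matrix.add_kronecker _ _ _

/-- `onB` as a ring homomorphism. -/
def onBRingHom (S B : Type*) [Fintype S] [DecidableEq S] [Fintype B] [DecidableEq B] :
    Matrix B B ℂ →+* Matrix (S × B) (S × B) ℂ where
  toFun := onB S
  map_one' := Matrix.one_kronecker_one
  map_mul' A C := by simp [onB, ← Matrix.mul_kronecker_mul]
  map_zero' := Matrix.kronecker_zero _
  map_add' A C := Matrix.kronecker_add _ _ _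

/-- `onS` as a continuous real-linear map. -/
def onSCLM (S B : Type*) [Fintype S] [DecidableEq S] [Fintype B] [DecidableEq B] :
    Matrix S S ℂ →L[ℝ] Matrix (S × B) (S × B) ℂ :=
  LinearMap.toContinuousLinearMap
    { toFun := onS B
      map_add' := fun _ _ => Matrix.add_kronecker _ _ _
      map_smul' := fun _ _ => Matrix.smul_kronecker _ _ _ }

@[simp] theorem onSCLM_apply (A : Matrix S S ℂ) : onSCLM S B A = onS B A := rfl

theorem onS_smul (c : ℝ) (A : Matrix S S ℂ) : onS B (c • A) = c • onS B A :=
  map_smul (onSCLM S B) c A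

theorem onS_add (A C : Matrix S S ℂ) : onS B (A + C) = onS B A + onS B C :=
  map_add (onSCLM S B) A C

theorem onS_sub (A C : Matrix S S ℂ) : onS B (A - C) = onS B A - onS B C :=
  map_sub (onSCLM S B) A C

theorem onS_one : onS B (1 : Matrix S S ℂ) = 1 := map_one (onSRingHom S B)

theorem onB_smul (c : ℝ) (A : Matrix B B ℂ) : onB S (c • A) = c • onB S A :=
  Matrix.kronecker_smul _ _ _

theorem exp_onS (A : Matrix S S ℂ) : exp (onS B A) = onS B (exp A) := by
  let : NormedAlgebra ℚ (Matrix S S ℂ) := NormedAlgebra.restrictScalars ℚ ℝ _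
  exact (map_exp (onSRingHom S B) (onSCLM S B).continuous A).symm

theorem exp_onB (A : Matrix B B ℂ) : exp (onB S A) = onB S (exp A) := by
  let : NormedAlgebra ℚ (Matrix B B ℂ) := NormedAlgebra.restrictScalars ℚ ℝ _
  refine (map_exp (onBRingHom S B) ?_ A).symm
  refine continuous_matrix fun i j => ?_
  exact continuous_const.mul (continuous_id.matrix_elem _ _)

theorem onS_mul_onB (A : Matrix S S ℂ) (C : Matrix B B ℂ) : onS B A * onB S C = A ⊗ₖ C := by
  simp [onS, onB, ← Matrix.mul_kronecker_mul]

theorem onB_mul_onS (A : Matrix S S ℂ) (C : Matrix B B ℂ) : onB S C * onS B A = A ⊗ₖ C := by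
  simp [onS, onB, ← Matrix.mul_kronecker_mul]

theorem exp_smul_freeHam (c : ℝ) (HB : Matrix B B ℂ) (X : Matrix S S ℂ) :
    exp (c • freeHam HB X) = exp (c • X) ⊗ₖ exp (c • HB) := by
  rw [freeHam, smul_add, ← onS_smul, ← onB_smul, Matrix.exp_add_of_commute, exp_onS, exp_onB,
    onS_mul_onB]
  rw [commute_iff_eq, onS_mul_onB, onB_mul_onS]

theorem partition_freeHam (β : ℝ) (HB : Matrix B B ℂ) (X : Matrix S S ℂ) :
    partition β (freeHam HB X) = partition β X * partition β HB := by
  rw [partition, exp_smul_freeHam, Matrix.trace_kronecker, partition, partition]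

theorem gibbs_freeHam (β : ℝ) (HB : Matrix B B ℂ) (X : Matrix S S ℂ) :
    gibbs β (freeHam HB X) = gibbs β X ⊗ₖ gibbs β HB := by
  rw [gibbs_eq, partition_freeHam, exp_smul_freeHam, gibbs_eq, gibbs_eq, Matrix.smul_kronecker,
    Matrix.kronecker_smul, smul_smul, mul_inv]

theorem logPartition_freeHam [Nonempty S] [Nonempty B] (β : ℝ) {HB : Matrix B B ℂ}
    {X : Matrix S S ℂ} (hB : HB.IsHermitian) (hX : X.IsHermitian) :
    logPartition β (freeHam HB X) = logPartition β X + logPartition β HB := by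
  rw [logPartition, partition_freeHam, ← ofReal_partition_re β hX, Complex.re_ofReal_mul,
    Real.log_mul (partition_re_pos β hX).ne' (partition_re_pos β hB).ne']
  rfl

theorem trace_traceB (M : Matrix (S × B) (S × B) ℂ) : (traceB M).trace = M.trace := by
  simp [Matrix.trace, traceB, Fintype.sum_prod_type]

theorem traceB_sub (M N : Matrix (S × B) (S × B) ℂ) : traceB (M - N) = traceB M - traceB N := by
  ext i j
  simp [traceB]

theorem traceB_onS_mul (A : Matrix S S ℂ) (M : Matrix (S × B) (S × B) ℂ) :
    traceB (onS B A * M) = A * traceB M := by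
  ext i j
  simp only [traceB, onS, Matrix.of_apply, Matrix.mul_apply, Matrix.kroneckerMap_apply,
    Fintype.sum_prod_type, Matrix.one_apply, mul_ite, mul_one, mul_zero, ite_mul, zero_mul,
    Finset.sum_ite_eq, Finset.mem_univ, if_true, Finset.mul_sum]
  exact Finset.sum_comm

theorem trace_onS_mul (A : Matrix S S ℂ) (M : Matrix (S × B) (S × B) ℂ) :
    (onS B A * M).trace = (A * traceB M).trace := by
  rw [← trace_traceB, traceB_onS_mul]

theorem traceB_onB_mul (C : Matrix B B ℂ) (M : Matrix (S × B) (S × B) ℂ) :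
    traceB (onB S C * M) = traceB (M * onB S C) := by
  ext i j
  simp only [traceB, onB, Matrix.of_apply, Matrix.mul_apply, Matrix.kroneckerMap_apply,
    Fintype.sum_prod_type, Matrix.one_apply, mul_ite, one_mul, mul_zero, ite_mul, zero_mul,
    Finset.sum_ite_irrel, Finset.sum_const_zero,
    Finset.sum_ite_eq, Finset.sum_ite_eq', Finset.mem_univ, if_true]
  rw [Finset.sum_comm]
  simp only [mul_comm]

theorem traceB_kronecker (A : Matrix S S ℂ) (C : Matrix B B ℂ) :
    traceB (A ⊗ₖ C) = C.trace • A := by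
  ext i j
  simp [traceB, Matrix.trace, ← Finset.mul_sum, mul_comm]

theorem isHermitian_onS {A : Matrix S S ℂ} (hA : A.IsHermitian) : (onS B A).IsHermitian := by
  rw [Matrix.IsHermitian, onS, Matrix.conjTranspose_kronecker, hA.eq, Matrix.conjTranspose_one]

theorem isHermitian_onB {A : Matrix B B ℂ} (hA : A.IsHermitian) : (onB S A).IsHermitian := by
  rw [Matrix.IsHermitian, onB, Matrix.conjTranspose_kronecker, hA.eq, Matrix.conjTranspose_one]

theorem isHermitian_freeHam {HB : Matrix B B ℂ} {X : Matrix S S ℂ} (hB : HB.IsHermitian)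
    (hX : X.IsHermitian) : (freeHam HB X).IsHermitian :=
  (isHermitian_onS hX).add (isHermitian_onB hB)

theorem conjTranspose_traceB (M : Matrix (S × B) (S × B) ℂ) :
    (traceB M).conjTranspose = traceB M.conjTranspose := by
  ext i j
  simp [traceB]

theorem isHermitian_meanCoupling [Nonempty B] (β : ℝ) {HB : Matrix B B ℂ}
    {V : Matrix (S × B) (S × B) ℂ} (hB : HB.IsHermitian) (hV : V.IsHermitian) :
    (meanCoupling β HB V).IsHermitian := by
  rw [Matrix.IsHermitian, meanCoupling, conjTranspose_traceB, Matrix.conjTranspose_mul, hV.eq,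
    (isHermitian_onB (isHermitian_gibbs β hB)).eq, traceB_onB_mul]

theorem dressed_eq (β : ℝ) (HB : Matrix B B ℂ) (V : Matrix (S × B) (S × B) ℂ) :
    dressed β HB V = V - onS B (meanCoupling β HB V) := by
  rw [dressed, meanCoupling, traceB_onB_mul]

/-- The purpose of the dressing: the mean force is subtracted, so the thermal bath average of what
remains is zero. -/
theorem traceB_gibbs_mul_dressed [Nonempty B] (β : ℝ) {HB : Matrix B B ℂ}
    (hB : HB.IsHermitian) (V : Matrix (S × B) (S × B) ℂ) :
    traceB (onB S (gibbs β HB) * dressed β HB V) = 0 := by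
  rw [dressed_eq, mul_sub, traceB_sub, onB_mul_onS, traceB_kronecker, trace_gibbs β hB, one_smul,
    meanCoupling, sub_self]

/-- Along a variation of the system Hamiltonian the Gibbs state stays a product with the fixed bath
state. -/
theorem fderiv_gibbs_freeHam [Nonempty S] [Nonempty B] (β : ℝ) {HB : Matrix B B ℂ}
    {X : Matrix S S ℂ} (hB : HB.IsHermitian) (hX : X.IsHermitian) {A : Matrix S S ℂ}
    (hA : A.IsHermitian) :
    fderiv ℝ (gibbs β) (freeHam HB X) (onS B A)
      = onS B (fderiv ℝ (gibbs β) X A) * onB S (gibbs β HB) := by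
  have h1 := hasDerivAt_gibbs_line β (isHermitian_freeHam hB hX) (isHermitian_onS (B := B) hA) 0
  have h2 := ((onSCLM S B).hasFDerivAt.comp_hasDerivAt (0 : ℝ)
    (hasDerivAt_gibbs_line β hX hA 0)).mul_const (onB S (gibbs β HB))
  have h3 : (fun t : ℝ => gibbs β (freeHam HB X + t • onS B A))
      = fun t : ℝ => onS B (gibbs β (X + t • A)) * onB S (gibbs β HB) := by
    ext1 t
    rw [onS_mul_onB, ← gibbs_freeHam, freeHam, freeHam, onS_add, onS_smul]
    congr 1
    abel
  rw [h3] at h1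
  have h4 := h1.unique h2
  simpa using h4

/-- The derivative of the Gibbs state is a system operator times the bath state, and the bath
average of the dressed interaction vanishes. This decouples the choice of `X` from `Ṽ`. -/
theorem kuboMori_onS_dressed [Nonempty S] [Nonempty B] (β : ℝ) {HB : Matrix B B ℂ}
    {X : Matrix S S ℂ} (hB : HB.IsHermitian) (hX : X.IsHermitian) {A : Matrix S S ℂ}
    (hA : A.IsHermitian) (V : Matrix (S × B) (S × B) ℂ) :
    kuboMori β (freeHam HB X) (onS B A) (dressed β HB V) = 0 := by
  rw [kuboMori, fderiv_gibbs_freeHam β hB hX hA, mul_assoc, trace_onS_mul,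
    traceB_gibbs_mul_dressed β hB, mul_zero]
  simp

theorem onS_injective [Nonempty B] :
    Function.Injective (onS B : Matrix S S ℂ → Matrix (S × B) (S × B) ℂ) := by
  intro A C h
  ext i j
  obtain ⟨b⟩ := ‹Nonempty B›
  have := congrFun (congrFun h (i, b)) (j, b)
  simpa [onS] using this

theorem trace_onS (A : Matrix S S ℂ) : (onS B A).trace = A.trace * Fintype.card B := by
  rw [onS, Matrix.trace_kronecker, Matrix.trace_one]

/-! ### Removing multiples of the identity; common properties of the losses -/

section Traceless

/-- The real space of traceless Hermitian matrices. -/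
def tracelessHermitian (n : Type*) [Fintype n] [DecidableEq n] :
    Submodule ℝ (Matrix n n ℂ) where
  carrier := {E | E.IsHermitian ∧ E.trace = 0}
  add_mem' h h' := ⟨h.1.add h'.1, by rw [Matrix.trace_add, h.2, h'.2, add_zero]⟩
  zero_mem' := ⟨Matrix.isHermitian_zero, Matrix.trace_zero n ℂ⟩
  smul_mem' c E h := ⟨isHermitian_smul h.1 c, by rw [Matrix.trace_smul, h.2, smul_zero]⟩

/-- The average of the diagonal entries. -/
def meanTrace (A : Matrix n n ℂ) : ℝ := A.trace.re / Fintype.card n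

theorem trace_eq_ofReal_re {A : Matrix n n ℂ} (hA : A.IsHermitian) : A.trace = A.trace.re := by
  simpa using trace_mul_eq_ofReal_re hA Matrix.isHermitian_one

theorem sub_meanTrace_mem [Nonempty n] {A : Matrix n n ℂ} (hA : A.IsHermitian) :
    A - meanTrace A • (1 : Matrix n n ℂ) ∈ tracelessHermitian n := by
  refine ⟨hA.sub (isHermitian_smul_one _), ?_⟩
  have h : (Fintype.card n : ℂ) ≠ 0 := by exact_mod_cast Fintype.card_ne_zero
  rw [Matrix.trace_sub, Matrix.trace_smul, Matrix.trace_one, trace_eq_ofReal_re hA, meanTrace]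
  rw [Complex.real_smul]
  push_cast
  field_simp
  simp

/-- The Kubo-Mori form, halved, on the traceless Hermitian matrices. -/
def kuboMoriForm (β : ℝ) (K : Matrix n n ℂ) :
    tracelessHermitian n →ₗ[ℝ] tracelessHermitian n →ₗ[ℝ] ℝ :=
  LinearMap.mk₂ ℝ (fun E D => kuboMori β K E D / 2)
    (fun E E' D => by simp [kuboMori_add_left, add_div])
    (fun c E D => by simp [kuboMori_smul_left, mul_div_assoc])
    (fun E D D' => by simp [kuboMori_add_right, add_div])
    (fun c E D => by simp [kuboMori_smul_right, mul_div_assoc])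

/-- The properties shared by the two free energy losses as functions of the perturbation `E` of
the Hamiltonian `K`. -/
structure IsEnergyLoss (β : ℝ) (K : Matrix n n ℂ) (Φ : Matrix n n ℂ → ℝ) : Prop where
  zero : Φ 0 = 0
  monotoneOn : ∀ E, E.IsHermitian → MonotoneOn (fun t : ℝ => Φ (t • E)) (Ici 0)
  approx : QuadraticApprox Matrix.IsHermitian Φ fun E => kuboMori β K E E / 2
  add_smul_one : ∀ E, E.IsHermitian → ∀ c : ℝ, Φ (E + c • (1 : Matrix n n ℂ)) = Φ E
  continuousAt : ∀ E, E.IsHermitian → ContinuousAt Φ E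

theorem isEnergyLoss_right [Nonempty n] {β : ℝ} (hβ : 0 < β) {K : Matrix n n ℂ}
    (hK : K.IsHermitian) : IsEnergyLoss β K fun E => gibbsDivergence β K (K + E) where
  zero := by rw [add_zero, gibbsDivergence_self]
  monotoneOn E hE := monotoneOn_gibbsDivergence_right hβ hK hE
  approx := quadraticApprox_gibbsDivergence_right hβ hK
  add_smul_one E hE c := by
    rw [← add_assoc, gibbsDivergence_add_smul_one_right hβ.ne' hK (hK.add hE)]
  continuousAt E hE := ContinuousAt.comp (f := fun E : Matrix n n ℂ => (K, K + E))
    (g := fun p : Matrix n n ℂ × Matrix n n ℂ => gibbsDivergence β p.1 p.2)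
    (continuousAt_gibbsDivergence β hK (hK.add hE)) (by fun_prop)

theorem isEnergyLoss_left [Nonempty n] {β : ℝ} (hβ : 0 < β) {K : Matrix n n ℂ}
    (hK : K.IsHermitian) : IsEnergyLoss β K fun E => gibbsDivergence β (K + E) K where
  zero := by rw [add_zero, gibbsDivergence_self]
  monotoneOn E hE := monotoneOn_gibbsDivergence_left hβ hK hE
  approx := quadraticApprox_gibbsDivergence_left hβ hK
  add_smul_one E hE c := by
    rw [← add_assoc, gibbsDivergence_add_smul_one_left hβ.ne' (hK.add hE)]
  continuousAt E hE := ContinuousAt.comp (f := fun E : Matrix n n ℂ => (K + E, K))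
    (g := fun p : Matrix n n ℂ × Matrix n n ℂ => gibbsDivergence β p.1 p.2)
    (continuousAt_gibbsDivergence β (hK.add hE) hK) (by fun_prop)

theorem IsEnergyLoss.exists_bound {β : ℝ} {K : Matrix n n ℂ} {Φ : Matrix n n ℂ → ℝ}
    (h : IsEnergyLoss β K Φ) :
    ∃ C r : ℝ, 0 < r ∧ ∀ E, E.IsHermitian → ‖E‖ ≤ r → |Φ E| ≤ C * ‖E‖ ^ 2 := by
  obtain ⟨C, r, hC, hr, hb⟩ := h.approx
  refine ⟨C * r + ‖traceCLM n‖ * ‖fderiv ℝ (gibbs β) K‖ / 2, r, hr, fun E hE hEr => ?_⟩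
  have h1 := hb E 0 ‖E‖ hE Matrix.isHermitian_zero le_rfl (by simp) hEr
  have h0 : kuboMori β K 0 0 = 0 := by simp [kuboMori]
  simp only [h.zero, h0, zero_div, sub_zero] at h1
  have h2 : |kuboMori β K E E| ≤ ‖traceCLM n‖ * ‖fderiv ℝ (gibbs β) K‖ * ‖E‖ ^ 2 := by
    rw [kuboMori, abs_neg]
    calc _ ≤ ‖traceCLM n‖ * ((‖fderiv ℝ (gibbs β) K‖ * ‖E‖) * ‖E‖) :=
          (abs_re_trace_mul_le _ _).trans (by gcongr; exact ContinuousLinearMap.le_opNorm _ _)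
      _ = _ := by ring
  have h3 : C * ‖E‖ ^ 2 * ‖E‖ ≤ C * ‖E‖ ^ 2 * r := by gcongr
  rw [abs_le] at h1 h2 ⊢
  constructor <;> linarith [h1.1, h1.2, h2.1, h2.2]

end Traceless

/-! ### Optimal Hamiltonians and minimal losses -/

/-- `onS` between the spaces of traceless Hermitian matrices. -/
def onSTraceless (S B : Type*) [Fintype S] [DecidableEq S] [Fintype B] [DecidableEq B] :
    tracelessHermitian S →ₗ[ℝ] tracelessHermitian (S × B) :=
  (onSCLM S B).toLinearMap.restrict fun A hA =>
    ⟨isHermitian_onS hA.1, by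
      rw [ContinuousLinearMap.coe_coe, onSCLM_apply, trace_onS, hA.2, zero_mul]⟩

theorem onSTraceless_coe (A : tracelessHermitian S) :
    (onSTraceless S B A : Matrix (S × B) (S × B) ℂ) = onS B (A : Matrix S S ℂ) := rfl

theorem coupledHam_eq (HB : Matrix B B ℂ) (W : Matrix (S × B) (S × B) ℂ) (H X : Matrix S S ℂ) :
    coupledHam HB W X = freeHam HB H + (onS B (X - H) + W) := by
  rw [coupledHam, freeHam, freeHam, onS_sub]
  abel

theorem isHermitian_coupledHam {HB : Matrix B B ℂ} {W : Matrix (S × B) (S × B) ℂ}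
    {X : Matrix S S ℂ} (hB : HB.IsHermitian) (hW : W.IsHermitian) (hX : X.IsHermitian) :
    (coupledHam HB W X).IsHermitian := (isHermitian_freeHam hB hX).add hW

/-- `exists_perturbed_minimum` applied on traceless Hermitian matrices, with `v` the traceless part
of `Ṽ` and `u` the traceless part of the deviation of `X` from `H - g M`. One constant serves all
small `g` and all minimisers, which gives the statement about arbitrary optimal families. -/
theorem exists_optimal_local [Nonempty S] [Nonempty B] {β : ℝ} (hβ : 0 < β)
    {HB : Matrix B B ℂ} {H : Matrix S S ℂ} {V : Matrix (S × B) (S × B) ℂ}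
    (hB : HB.IsHermitian) (hH : H.IsHermitian) (hV : V.IsHermitian)
    {Φ : Matrix (S × B) (S × B) ℂ → ℝ} (hΦ : IsEnergyLoss β (freeHam HB H) Φ)
    {F : ℝ → Matrix S S ℂ → ℝ}
    (hF : ∀ g X, X.IsHermitian → F g X = Φ (onS B (X - H) + g • V)) :
    ∃ δ C : ℝ, 0 < δ ∧ ∀ g : ℝ, |g| < δ →
      (∃ X, IsOptimal (F g) X ∧ meanTrace (X - (H - g • meanCoupling β HB V)) = 0) ∧
      ∀ X, IsOptimal (F g) X →
        ‖X - (H - g • meanCoupling β HB V)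
          + (-meanTrace (X - (H - g • meanCoupling β HB V))) • (1 : Matrix S S ℂ)‖ ≤ C * g ^ 2 ∧
        |F g X - β * g ^ 2 / 2 * (cov β (freeHam HB H) (dressed β HB V)
          (dressed β HB V)).re| ≤ C * |g| ^ 3 := by
  set M := meanCoupling β HB V with hM
  set K := freeHam HB H with hKdef
  have hK : K.IsHermitian := isHermitian_freeHam hB hH
  have hMh : M.IsHermitian := isHermitian_meanCoupling β hB hV
  have hDh : (dressed β HB V).IsHermitian := by
    rw [dressed_eq]
    exact hV.sub (isHermitian_onS hMh)
  set c₀ := meanTrace (dressed β HB V)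
  set v : tracelessHermitian (S × B) :=
    ⟨dressed β HB V - c₀ • (1 : Matrix (S × B) (S × B) ℂ), sub_meanTrace_mem hDh⟩ with hv
  have hvD : dressed β HB V = (v : Matrix (S × B) (S × B) ℂ) + c₀ • 1 := by simp [hv]
  have hvV : ∀ g : ℝ, g • V = g • ((v : Matrix (S × B) (S × B) ℂ) + c₀ • 1 + onS B M) := by
    intro g
    rw [← hvD, dressed_eq, sub_add_cancel]
  set f : tracelessHermitian (S × B) → ℝ := fun E => Φ E with hf
  have hkm : ∀ E D : tracelessHermitian (S × B),
      kuboMoriForm β K E D = kuboMori β K E D / 2 := fun E D => rfl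
  have horth : ∀ u : tracelessHermitian S, kuboMori β K (onSTraceless S B u) v = 0 := by
    intro u
    have h := kuboMori_onS_dressed β hB hH u.2.1 V
    rw [hvD, ← add_zero (onS B (u : Matrix S S ℂ)),
      ← zero_smul ℝ (1 : Matrix (S × B) (S × B) ℂ), kuboMori_add_smul_one β hK] at h
    exact h
  obtain ⟨δ, C, hδ, hmain⟩ := exists_perturbed_minimum (f := f) (B := kuboMoriForm β K)
    (ι := onSTraceless S B) (v := v)
    (fun E hE => by
      rw [hkm]
      exact half_pos ((kuboMori_self hβ hK E.2.1).2 E.2.2 fun h => hE (Subtype.ext h)))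
    (continuous_iff_continuousAt.2 fun E =>
      (hΦ.continuousAt E E.2.1).comp continuous_subtype_val.continuousAt)
    hΦ.zero (fun E => hΦ.monotoneOn E E.2.1)
    (by
      obtain ⟨C, r, hC, hr, h⟩ := hΦ.approx
      exact ⟨C, r, hC, hr, fun x y s _ _ => h x y s x.2.1 y.2.1⟩)
    (fun A C h => Subtype.ext (onS_injective (congrArg Subtype.val h)))
    (fun u => by rw [hkm, hkm, kuboMori_comm β hK v, horth, zero_div]; exact ⟨rfl, rfl⟩)
  have hval : kuboMoriForm β K v v
      = β / 2 * (cov β K (dressed β HB V) (dressed β HB V)).re := by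
    rw [hkm, ← kuboMori_add_smul_one β hK v v c₀ c₀, ← hvD, kuboMori_eq_cov β hK]
    ring
  -- The mean coupling contained in `g V` cancels the shift `-g M`; the leftover multiple of the
  -- identity does not affect the loss.
  have hF' : ∀ (g : ℝ) (X : Matrix S S ℂ) (u : tracelessHermitian S) (c : ℝ),
      X.IsHermitian → X - (H - g • M) = u + c • 1 → F g X = f (onSTraceless S B u + g • v) := by
    intro g X u c hX hu
    have h1 : onS B (X - H) + g • V
        = ((onSTraceless S B u + g • v : tracelessHermitian (S × B)) : Matrix (S × B) (S × B) ℂ)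
          + (c + g * c₀) • 1 := by
      have h2 : X - H = u + c • 1 - g • M := by rw [← hu]; abel
      rw [h2, onS_sub, onS_add, onS_smul, onS_smul, onS_one, Submodule.coe_add,
        Submodule.coe_smul, onSTraceless_coe, hvV]
      module
    rw [hF g X hX, h1, hΦ.add_smul_one _ (onSTraceless S B u + g • v).2.1]
  have hHM : ∀ g : ℝ, (H - g • M).IsHermitian := fun g => hH.sub (isHermitian_smul hMh g)
  refine ⟨δ, C, hδ, fun g hg => ⟨?_, fun X hX => ?_⟩⟩
  · obtain ⟨u, hu⟩ := (hmain g hg).1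
    have hXh : (H - g • M + u).IsHermitian := (hHM g).add u.2.1
    refine ⟨H - g • M + u, ⟨hXh, fun Y hY => ?_⟩, ?_⟩
    · rw [hF' g _ u 0 hXh (by simp),
        hF' g Y ⟨_, sub_meanTrace_mem (hY.sub (hHM g))⟩ (meanTrace (Y - (H - g • M))) hY (by simp)]
      exact hu _
    · rw [add_sub_cancel_left, meanTrace, u.2.2]
      simp
  · set u : tracelessHermitian S := ⟨_, sub_meanTrace_mem (hX.1.sub (hHM g))⟩ with hu
    have hXu := hF' g X u (meanTrace (X - (H - g • M))) hX.1 (by simp [hu])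
    have h := (hmain g hg).2 u fun u' => by
      have hYh : (H - g • M + u').IsHermitian := (hHM g).add u'.2.1
      rw [← hXu, ← hF' g _ u' 0 hYh (by simp)]
      exact hX.2 _ hYh
    constructor
    · rw [neg_smul, ← sub_eq_add_neg]
      exact h.1
    · rw [hXu]
      convert h.2 using 2
      rw [hval]
      ring

theorem minValue_eq {f : Matrix S S ℂ → ℝ} {X : Matrix S S ℂ} (hX : IsOptimal f X) :
    minValue f = f X := by
  refine IsLeast.csInf_eq ⟨⟨X, hX.1, rfl⟩, ?_⟩
  rintro _ ⟨Y, hY, rfl⟩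
  exact hX.2 Y hY

theorem isBigO_of_bound {E : Type*} [NormedAddCommGroup E] {u : ℝ → E} {C δ : ℝ} {k : ℕ}
    (hδ : 0 < δ) (h : ∀ g : ℝ, |g| < δ → ‖u g‖ ≤ C * |g| ^ k) :
    u =O[𝓝 0] fun g : ℝ => g ^ k := by
  refine Asymptotics.IsBigO.of_bound C ?_
  filter_upwards [Metric.ball_mem_nhds (0 : ℝ) hδ] with g hg
  rw [norm_pow, Real.norm_eq_abs]
  exact h g (by simpa using hg)

theorem optimal_expansion [Nonempty S] [Nonempty B] {β : ℝ} (hβ : 0 < β)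
    {HB : Matrix B B ℂ} {H : Matrix S S ℂ} {V : Matrix (S × B) (S × B) ℂ}
    (hB : HB.IsHermitian) (hH : H.IsHermitian) (hV : V.IsHermitian)
    {Φ : Matrix (S × B) (S × B) ℂ → ℝ} (hΦ : IsEnergyLoss β (freeHam HB H) Φ)
    {F : ℝ → Matrix S S ℂ → ℝ}
    (hF : ∀ g X, X.IsHermitian → F g X = Φ (onS B (X - H) + g • V)) :
    ((∃ X : ℝ → Matrix S S ℂ, (∀ᶠ g in 𝓝 (0 : ℝ), IsOptimal (F g) (X g)) ∧
        (fun g : ℝ => X g - (H - g • meanCoupling β HB V)) =O[𝓝 0] fun g : ℝ => g ^ 2) ∧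
      (∀ X : ℝ → Matrix S S ℂ, (∀ᶠ g in 𝓝 (0 : ℝ), IsOptimal (F g) (X g)) →
        ∃ c : ℝ → ℝ,
          (fun g : ℝ => X g - (H - g • meanCoupling β HB V + c g • (1 : Matrix S S ℂ)))
            =O[𝓝 0] fun g : ℝ => g ^ 2)) ∧
    (fun g : ℝ => minValue (F g) - β * g ^ 2 / 2 * (cov β (freeHam HB H)
        (dressed β HB V) (dressed β HB V)).re) =O[𝓝 0] fun g : ℝ => g ^ 3 := by
  obtain ⟨δ, C, hδ, h⟩ := exists_optimal_local hβ hB hH hV hΦ hF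
  have hev : ∀ᶠ g in 𝓝 (0 : ℝ), |g| < δ := by
    filter_upwards [Metric.ball_mem_nhds (0 : ℝ) hδ] with g hg
    simpa using hg
  refine ⟨⟨?_, fun X hX => ?_⟩, ?_⟩
  · choose! X hX using fun g hg => (h g hg).1
    refine ⟨X, hev.mono fun g hg => (hX g hg).1, isBigO_of_bound (C := C) hδ fun g hg => ?_⟩
    have h1 := ((h g hg).2 _ (hX g hg).1).1
    rw [(hX g hg).2] at h1
    simpa using h1
  · refine ⟨fun g => meanTrace (X g - (H - g • meanCoupling β HB V)), ?_⟩
    refine Asymptotics.IsBigO.of_bound C ?_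
    filter_upwards [hX, hev] with g hXg hg
    have h1 := ((h g hg).2 _ hXg).1
    rw [norm_pow, Real.norm_eq_abs, sq_abs, ← sub_sub]
    rwa [neg_smul, ← sub_eq_add_neg] at h1
  · refine isBigO_of_bound (C := C) hδ fun g hg => ?_
    obtain ⟨X, hX, -⟩ := (h g hg).1
    rw [minValue_eq hX]
    exact ((h g hg).2 X hX).2

/-- The total perturbation is of order `g` and the loss is quadratically small; optimality plays no
role. -/
theorem energyLoss_isBigO {β : ℝ} {HB : Matrix B B ℂ} {H : Matrix S S ℂ}
    {V : Matrix (S × B) (S × B) ℂ} (hH : H.IsHermitian) (hV : V.IsHermitian)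
    {Φ : Matrix (S × B) (S × B) ℂ → ℝ} (hΦ : IsEnergyLoss β (freeHam HB H) Φ)
    {X : ℝ → Matrix S S ℂ} (hX : ∀ g, (X g).IsHermitian)
    (hXO : (fun g : ℝ => X g - H) =O[𝓝 0] fun g : ℝ => g) :
    (fun g : ℝ => Φ (onS B (X g - H) + g • V)) =O[𝓝 0] fun g : ℝ => g ^ 2 := by
  obtain ⟨C, r, hr, h⟩ := hΦ.exists_bound
  have h1 : (fun g : ℝ => onS B (X g - H) + g • V) =O[𝓝 0] fun g : ℝ => g := by
    refine Asymptotics.IsBigO.add (((onSCLM S B).isBigO_comp _ _).trans hXO) ?_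
    refine Asymptotics.IsBigO.of_bound ‖V‖ (Eventually.of_forall fun g => ?_)
    rw [norm_smul, mul_comm]
  have h2 : Tendsto (fun g : ℝ => onS B (X g - H) + g • V) (𝓝 0) (𝓝 0) :=
    h1.trans_tendsto tendsto_id
  have h3 : (fun g : ℝ => Φ (onS B (X g - H) + g • V)) =O[𝓝 0]
      fun g : ℝ => ‖onS B (X g - H) + g • V‖ ^ 2 := by
    refine Asymptotics.IsBigO.of_bound C ?_
    filter_upwards [h2 (Metric.closedBall_mem_nhds 0 hr)] with g hg
    rw [norm_pow, norm_norm]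
    exact h _ ((isHermitian_onS ((hX g).sub hH)).add (isHermitian_smul hV g)) (by simpa using hg)
  exact h3.trans (h1.norm_left.pow 2)

/-! ### Work as the weak-coupling value minus divergences -/

theorem deltaFIrr_eq [Nonempty S] [Nonempty B] {β : ℝ} (hβ : 0 < β) {H X : Matrix S S ℂ}
    {HB : Matrix B B ℂ} {W : Matrix (S × B) (S × B) ℂ} (hH : H.IsHermitian)
    (hB : HB.IsHermitian) (hW : W.IsHermitian) (hX : X.IsHermitian) :
    deltaFIrr β (gibbs β H) HB W X = gibbsDivergence β (freeHam HB H) (coupledHam HB W X) := by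
  rw [deltaFIrr, initialState, ← gibbs_freeHam, freeEnergy_sub_freeEnergy_gibbs hβ.ne'
    (isHermitian_freeHam hB hH) (isHermitian_coupledHam hB hW hX)]

theorem deltaFRes_eq [Nonempty S] [Nonempty B] {β : ℝ} (hβ : 0 < β) {H Z : Matrix S S ℂ}
    {HB : Matrix B B ℂ} {W : Matrix (S × B) (S × B) ℂ} (hH : H.IsHermitian)
    (hB : HB.IsHermitian) (hW : W.IsHermitian) (hZ : Z.IsHermitian) :
    deltaFRes β H HB W Z = gibbsDivergence β (coupledHam HB W Z) (freeHam HB H) := by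
  rw [deltaFRes, freeEnergy_sub_freeEnergy_gibbs hβ.ne' (isHermitian_coupledHam hB hW hZ)
    (isHermitian_freeHam hB hH)]

/-- The log-partition functions telescope, leaving only those at the two ends. -/
theorem sum_gibbsDivergence {n : Type*} [Fintype n] [DecidableEq n] (β : ℝ)
    (K : ℕ → Matrix n n ℂ) (N : ℕ) :
    ∑ i ∈ Finset.range N, gibbsDivergence β (K i) (K (i + 1))
      = -∑ i ∈ Finset.range N, (gibbs β (K i) * (K i - K (i + 1))).trace.re
        - β⁻¹ * logPartition β (K 0) + β⁻¹ * logPartition β (K N) := by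
  induction N with
  | zero => simp
  | succ N ih =>
    rw [Finset.sum_range_succ, ih, Finset.sum_range_succ, gibbsDivergence,
      ← neg_sub (K N) (K (N + 1)), mul_neg, Matrix.trace_neg, Complex.neg_re]
    ring

theorem coupledHam_sub_coupledHam (HB : Matrix B B ℂ) (W : Matrix (S × B) (S × B) ℂ)
    (X Y : Matrix S S ℂ) : coupledHam HB W X - coupledHam HB W Y = onS B (X - Y) := by
  rw [coupledHam, coupledHam, freeHam, freeHam, onS_sub]
  abel

theorem trace_mul_onS (M : Matrix (S × B) (S × B) ℂ) (A : Matrix S S ℂ) :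
    (M * onS B A).trace = (traceB M * A).trace := by
  rw [Matrix.trace_mul_comm, trace_onS_mul, Matrix.trace_mul_comm]

theorem weakWork_eq [Nonempty S] {β : ℝ} (hβ : 0 < β) {Ht H : Matrix S S ℂ}
    (hHt : Ht.IsHermitian) (hH : H.IsHermitian) :
    weakWork β (gibbs β Ht) H = gibbsDivergence β Ht H :=
  freeEnergy_sub_freeEnergy_gibbs hβ.ne' hHt hH

/-- The extracted work is the weak coupling value minus the free energy losses of all steps. -/
theorem protocolWork_eq [Nonempty S] [Nonempty B] {β : ℝ} (hβ : 0 < β) {Ht H : Matrix S S ℂ}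
    {HB : Matrix B B ℂ} (hHt : Ht.IsHermitian) (hH : H.IsHermitian) (hB : HB.IsHermitian)
    (W : Matrix (S × B) (S × B) ℂ) (N : ℕ) (h : ℕ → Matrix S S ℂ) :
    protocolWork β (gibbs β Ht) H HB W N h
      = weakWork β (gibbs β Ht) H
        - gibbsDivergence β (freeHam HB Ht) (coupledHam HB W (h 0))
        - ∑ i ∈ Finset.range N,
            gibbsDivergence β (coupledHam HB W (h i)) (coupledHam HB W (h (i + 1)))
        - gibbsDivergence β (coupledHam HB W (h N)) (freeHam HB H) := by
  have h0 : (initialState β (gibbs β Ht) HB * (coupledHam HB W (h 0) - freeHam HB Ht)).trace.re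
      = (gibbs β Ht * (h 0 - Ht)).trace.re + (initialState β (gibbs β Ht) HB * W).trace.re := by
    rw [coupledHam_eq HB W Ht, add_sub_cancel_left, mul_add, Matrix.trace_add, trace_mul_onS,
      initialState, traceB_kronecker, trace_gibbs β hB, one_smul, Complex.add_re]
  have hN : (gibbs β (coupledHam HB W (h N)) * (freeHam HB H - coupledHam HB W (h N))).trace.re
      = -(gibbs β (coupledHam HB W (h N)) * W).trace.re
        - (traceB (gibbs β (coupledHam HB W (h N))) * (h N - H)).trace.re := by
    have e : freeHam HB H - coupledHam HB W (h N) = -W - onS B (h N - H) := by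
      rw [coupledHam_eq HB W H]
      abel
    rw [e, mul_sub, Matrix.trace_sub, trace_mul_onS, mul_neg, Matrix.trace_neg, Complex.sub_re,
      Complex.neg_re]
  have hsum : ∑ i ∈ Finset.range N,
        (traceB (gibbs β (coupledHam HB W (h i))) * (h i - h (i + 1))).trace.re
      = ∑ i ∈ Finset.range N, (gibbs β (coupledHam HB W (h i)) *
        (coupledHam HB W (h i) - coupledHam HB W (h (i + 1)))).trace.re := by
    refine Finset.sum_congr rfl fun i _ => ?_
    rw [coupledHam_sub_coupledHam, trace_mul_onS]
  have hS : (gibbs β Ht * (H - Ht)).trace.re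
      = (gibbs β Ht * (H - h 0)).trace.re + (gibbs β Ht * (h 0 - Ht)).trace.re := by
    rw [← Complex.add_re, ← Matrix.trace_add, ← mul_add, sub_add_sub_cancel]
  -- The end terms meet the log-partition functions of the uncoupled Hamiltonians; the bath
  -- contributions cancel between first and last contact.
  rw [sum_gibbsDivergence β (fun i => coupledHam HB W (h i)), protocolWork, hsum,
    weakWork_eq hβ hHt hH, gibbsDivergence, gibbsDivergence, gibbsDivergence, hN,
    gibbs_freeHam, ← initialState, h0, hS, logPartition_freeHam β hB hHt,
    logPartition_freeHam β hB hH]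
  ring

section Contact

variable [Nonempty S] [Nonempty B] {β : ℝ} {Ht H : Matrix S S ℂ} {HB : Matrix B B ℂ}
  {W : Matrix (S × B) (S × B) ℂ}

theorem protocolWork_le (hβ : 0 < β) (hHt : Ht.IsHermitian) (hH : H.IsHermitian)
    (hB : HB.IsHermitian) (hW : W.IsHermitian) (N : ℕ) {h : ℕ → Matrix S S ℂ}
    (hh : ∀ i, (h i).IsHermitian) :
    protocolWork β (gibbs β Ht) H HB W N h ≤ weakWork β (gibbs β Ht) H
        - deltaFIrr β (gibbs β Ht) HB W (h 0) - deltaFRes β H HB W (h N) := by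
  rw [protocolWork_eq hβ hHt hH hB, deltaFIrr_eq hβ hHt hB hW (hh 0),
    deltaFRes_eq hβ hH hB hW (hh N)]
  have : 0 ≤ ∑ i ∈ Finset.range N,
      gibbsDivergence β (coupledHam HB W (h i)) (coupledHam HB W (h (i + 1))) :=
    Finset.sum_nonneg fun i _ => gibbsDivergence_nonneg hβ
      (isHermitian_coupledHam hB hW (hh _)) (isHermitian_coupledHam hB hW (hh _))
  linarith

theorem bddAbove_workSet (hβ : 0 < β) (hHt : Ht.IsHermitian) (hH : H.IsHermitian)
    (hB : HB.IsHermitian) (hW : W.IsHermitian) :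
    BddAbove (workSet β (gibbs β Ht) H HB W) := by
  refine ⟨weakWork β (gibbs β Ht) H, ?_⟩
  rintro _ ⟨N, h, hh, rfl⟩
  have h1 := protocolWork_le hβ hHt hH hB hW N hh
  rw [deltaFIrr_eq hβ hHt hB hW (hh 0), deltaFRes_eq hβ hH hB hW (hh N)] at h1
  have h2 := gibbsDivergence_nonneg hβ (isHermitian_freeHam hB hHt)
    (isHermitian_coupledHam hB hW (hh 0))
  have h3 := gibbsDivergence_nonneg hβ (isHermitian_coupledHam hB hW (hh N))
    (isHermitian_freeHam hB hH)
  linarith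

/-- The dissipation along `N` equal quenches is at most of order `1 / N`. -/
theorem sum_gibbsDivergence_segment_le {n : Type*} [Fintype n] [DecidableEq n] [Nonempty n]
    (hβ : 0 < β) {K E : Matrix n n ℂ} (hK : K.IsHermitian) (hE : E.IsHermitian) (N : ℕ) :
    ∑ i ∈ Finset.range (N + 1), gibbsDivergence β (K + ((i : ℝ) / (N + 1)) • E)
        (K + (((i + 1 : ℕ) : ℝ) / (N + 1)) • E)
      ≤ ((gibbs β K - gibbs β (K + E)) * E).trace.re / (N + 1) := by
  have hN : (0 : ℝ) < (N : ℝ) + 1 := by positivity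
  set L : ℕ → Matrix n n ℂ := fun i => K + ((i : ℝ) / (N + 1)) • E with hL
  have hstep : ∀ i, gibbsDivergence β (L i) (L (i + 1))
      ≤ (gibbs β (L i) * E).trace.re / (N + 1) - (gibbs β (L (i + 1)) * E).trace.re / (N + 1) := by
    intro i
    -- The reversed step also has nonnegative divergence. In the sum of both directions the
    -- log-partition functions cancel, which bounds the forward one by a telescoping difference.
    have h1 := gibbsDivergence_nonneg hβ (isHermitian_line hK hE (((i + 1 : ℕ) : ℝ) / (N + 1)))
      (isHermitian_line hK hE ((i : ℝ) / (N + 1)))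
    change 0 ≤ gibbsDivergence β (L (i + 1)) (L i) at h1
    have e : L (i + 1) - L i = ((N : ℝ) + 1)⁻¹ • E := by
      simp only [hL, add_sub_add_left_eq_sub, ← sub_smul]
      congr 1
      push_cast
      field_simp
      ring
    have e' : L i - L (i + 1) = -(((N : ℝ) + 1)⁻¹ • E) := by rw [← e, neg_sub]
    rw [gibbsDivergence, e'] at h1
    rw [gibbsDivergence, e]
    simp only [mul_neg, mul_smul_comm, Matrix.trace_neg, Matrix.trace_smul, Complex.neg_re,
      Complex.smul_re, smul_eq_mul] at h1 ⊢
    rw [div_eq_inv_mul, div_eq_inv_mul]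
    linarith
  refine (Finset.sum_le_sum fun i _ => hstep i).trans_eq ?_
  rw [Finset.sum_range_sub', sub_mul, Matrix.trace_sub, Complex.sub_re, sub_div]
  congr 4
  · simp [hL]
  · simp only [hL]
    push_cast
    rw [div_self hN.ne', one_smul]

/-- The bound is approached, not necessarily attained: `N + 1` equal quenches from `X` to `Z` fall
short of it by at most `a / (N + 1)`. -/
theorem isLUB_contactWork (hβ : 0 < β) (hHt : Ht.IsHermitian) (hH : H.IsHermitian)
    (hB : HB.IsHermitian) (hW : W.IsHermitian) {X Z : Matrix S S ℂ} (hX : X.IsHermitian)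
    (hZ : Z.IsHermitian) :
    IsLUB {w | ∃ (N : ℕ) (h : ℕ → Matrix S S ℂ), (∀ i, (h i).IsHermitian) ∧ h 0 = X ∧ h N = Z ∧
        w = protocolWork β (gibbs β Ht) H HB W N h}
      (weakWork β (gibbs β Ht) H - deltaFIrr β (gibbs β Ht) HB W X - deltaFRes β H HB W Z) := by
  constructor
  · rintro _ ⟨N, h, hh, rfl, rfl, rfl⟩
    exact protocolWork_le hβ hHt hH hB hW N hh
  · intro b hb
    set a := ((gibbs β (coupledHam HB W X) - gibbs β (coupledHam HB W Z))
      * onS B (Z - X)).trace.re with ha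
    have hlim : Tendsto (fun N : ℕ => weakWork β (gibbs β Ht) H
        - deltaFIrr β (gibbs β Ht) HB W X - deltaFRes β H HB W Z - a / ((N : ℝ) + 1)) atTop
        (𝓝 (weakWork β (gibbs β Ht) H - deltaFIrr β (gibbs β Ht) HB W X
          - deltaFRes β H HB W Z - 0)) := by
      refine tendsto_const_nhds.sub ?_
      have := (tendsto_one_div_add_atTop_nhds_zero_nat (𝕜 := ℝ)).const_mul a
      simpa [div_eq_mul_inv] using this
    rw [sub_zero] at hlim
    refine le_of_tendsto' hlim fun N => ?_
    have hN : (0 : ℝ) < (N : ℝ) + 1 := by positivity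
    set h : ℕ → Matrix S S ℂ := fun i => X + ((i : ℝ) / (N + 1)) • (Z - X) with hh
    have h0 : h 0 = X := by simp [hh]
    have h1 : h (N + 1) = Z := by
      simp only [hh]
      push_cast
      rw [div_self hN.ne', one_smul, add_sub_cancel]
    have hherm : ∀ i, (h i).IsHermitian := fun i => isHermitian_line hX (hZ.sub hX) _
    refine le_trans ?_ (hb ⟨N + 1, h, hherm, h0, h1, rfl⟩)
    have hK : ∀ i, coupledHam HB W (h i)
        = coupledHam HB W X + ((i : ℝ) / (N + 1)) • onS B (Z - X) := by
      intro i
      rw [← onS_smul, ← sub_eq_iff_eq_add', coupledHam_sub_coupledHam, hh]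
      simp only [add_sub_cancel_left]
    have h2 := sum_gibbsDivergence_segment_le hβ (isHermitian_coupledHam hB hW hX)
      (isHermitian_onS (B := B) (hZ.sub hX)) N
    have hend : coupledHam HB W X + onS B (Z - X) = coupledHam HB W Z := by
      rw [← coupledHam_sub_coupledHam HB W, add_sub_cancel]
    simp only [← hK, hend] at h2
    rw [protocolWork_eq hβ hHt hH hB, h0, h1, deltaFIrr_eq hβ hHt hB hW hX,
      deltaFRes_eq hβ hH hB hW hZ]
    linarith

theorem contactWork_eq (hβ : 0 < β) (hHt : Ht.IsHermitian) (hH : H.IsHermitian)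
    (hB : HB.IsHermitian) (hW : W.IsHermitian) {X Z : Matrix S S ℂ} (hX : X.IsHermitian)
    (hZ : Z.IsHermitian) :
    contactWork β (gibbs β Ht) H HB W X Z
      = weakWork β (gibbs β Ht) H - deltaFIrr β (gibbs β Ht) HB W X - deltaFRes β H HB W Z :=
  (isLUB_contactWork hβ hHt hH hB hW hX hZ).csSup_eq
    -- Nonemptiness: a single quench from `X` to `Z`.
    ⟨_, 1, fun i => if i = 0 then X else Z, fun i => by dsimp only; split_ifs <;> assumption,
      rfl, rfl, rfl⟩

/-- The two end losses depend on `h 0` and `h N` separately, so they can be minimised independently;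
slow protocols between optimal ends then approach the bound. -/
theorem maxWork_eq (hβ : 0 < β) (hHt : Ht.IsHermitian) (hH : H.IsHermitian)
    (hB : HB.IsHermitian) (hW : W.IsHermitian) {X Z : Matrix S S ℂ}
    (hX : IsOptimal (deltaFIrr β (gibbs β Ht) HB W) X)
    (hZ : IsOptimal (deltaFRes β H HB W) Z) :
    maxWork β (gibbs β Ht) H HB W = weakWork β (gibbs β Ht) H
      - minValue (deltaFIrr β (gibbs β Ht) HB W) - minValue (deltaFRes β H HB W) := by
  rw [minValue_eq hX, minValue_eq hZ]
  have hlub := isLUB_contactWork hβ hHt hH hB hW hX.1 hZ.1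
  refine IsLUB.csSup_eq ⟨?_, fun b hb => hlub.2 ?_⟩
    ⟨_, 0, fun _ => X, fun _ => hX.1, rfl⟩
  · rintro _ ⟨N, h, hh, rfl⟩
    have h1 := protocolWork_le hβ hHt hH hB hW N hh
    have h2 := hX.2 _ (hh 0)
    have h3 := hZ.2 _ (hh N)
    linarith
  · rintro _ ⟨N, h, hh, -, -, rfl⟩
    exact hb ⟨N, h, hh, rfl⟩

end Contact

end StrongCoupling

end

/-! ### Assembly of the three claims -/

theorem mainTheorem4 {S B : Type*} [Fintype S] [DecidableEq S] [Nonempty S]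
    [Fintype B] [DecidableEq B] [Nonempty B]
    (β : ℝ) (hβ : 0 < β)
    (HS HtS ρS : Matrix S S ℂ) (HB : Matrix B B ℂ) (V : Matrix (S × B) (S × B) ℂ)
    (hHS : HS.IsHermitian) (hHB : HB.IsHermitian) (hV : V.IsHermitian)
    (hρ : ρS.PosDef) (hρtr : ρS.trace = 1)
    (hHtS : HtS.IsHermitian) (hHtρ : StrongCoupling.gibbs β HtS = ρS) :
    -- optimal Hamiltonian at which the coupling is turned on
    ((∃ X : ℝ → Matrix S S ℂ,
        (∀ᶠ g in 𝓝 (0 : ℝ),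
          StrongCoupling.IsOptimal (StrongCoupling.deltaFIrr β ρS HB (g • V)) (X g)) ∧
        (fun g : ℝ => X g - (HtS - g • StrongCoupling.meanCoupling β HB V))
          =O[𝓝 0] fun g : ℝ => g ^ 2) ∧
      (∀ X : ℝ → Matrix S S ℂ,
        (∀ᶠ g in 𝓝 (0 : ℝ),
          StrongCoupling.IsOptimal (StrongCoupling.deltaFIrr β ρS HB (g • V)) (X g)) →
        ∃ c : ℝ → ℝ,
          (fun g : ℝ => X g - (HtS - g • StrongCoupling.meanCoupling β HB V
              + c g • (1 : Matrix S S ℂ)))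
            =O[𝓝 0] fun g : ℝ => g ^ 2)) ∧
    -- optimal Hamiltonian at which the coupling is turned off
    ((∃ Z : ℝ → Matrix S S ℂ,
        (∀ᶠ g in 𝓝 (0 : ℝ),
          StrongCoupling.IsOptimal (StrongCoupling.deltaFRes β HS HB (g • V)) (Z g)) ∧
        (fun g : ℝ => Z g - (HS - g • StrongCoupling.meanCoupling β HB V))
          =O[𝓝 0] fun g : ℝ => g ^ 2) ∧
      (∀ Z : ℝ → Matrix S S ℂ,
        (∀ᶠ g in 𝓝 (0 : ℝ),
          StrongCoupling.IsOptimal (StrongCoupling.deltaFRes β HS HB (g • V)) (Z g)) →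
        ∃ c : ℝ → ℝ,
          (fun g : ℝ => Z g - (HS - g • StrongCoupling.meanCoupling β HB V
              + c g • (1 : Matrix S S ℂ)))
            =O[𝓝 0] fun g : ℝ => g ^ 2)) ∧
    -- minimal corrections
    ((fun g : ℝ => StrongCoupling.minValue (StrongCoupling.deltaFIrr β ρS HB (g • V))
        - β * g ^ 2 / 2 * (StrongCoupling.cov β (StrongCoupling.freeHam HB HtS)
            (StrongCoupling.dressed β HB V) (StrongCoupling.dressed β HB V)).re)
      =O[𝓝 0] fun g : ℝ => g ^ 3) ∧
    ((fun g : ℝ => StrongCoupling.minValue (StrongCoupling.deltaFRes β HS HB (g • V))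
        - β * g ^ 2 / 2 * (StrongCoupling.cov β (StrongCoupling.freeHam HB HS)
            (StrongCoupling.dressed β HB V) (StrongCoupling.dressed β HB V)).re)
      =O[𝓝 0] fun g : ℝ => g ^ 3) ∧
    -- the work: no correction of first order
    ((∀ g : ℝ, BddAbove (StrongCoupling.workSet β ρS HS HB (g • V))) ∧
      ((fun g : ℝ => StrongCoupling.maxWork β ρS HS HB (g • V)
          - (StrongCoupling.weakWork β ρS HS
            - β * g ^ 2 / 2 * (StrongCoupling.cov β (StrongCoupling.freeHam HB HtS)
                (StrongCoupling.dressed β HB V) (StrongCoupling.dressed β HB V)).re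
            - β * g ^ 2 / 2 * (StrongCoupling.cov β (StrongCoupling.freeHam HB HS)
                (StrongCoupling.dressed β HB V) (StrongCoupling.dressed β HB V)).re))
        =O[𝓝 0] fun g : ℝ => g ^ 3) ∧
      (∀ X Z : ℝ → Matrix S S ℂ,
        (∀ g, (X g).IsHermitian) → (∀ g, (Z g).IsHermitian) →
        ((fun g : ℝ => X g - HtS) =O[𝓝 0] fun g : ℝ => g) →
        ((fun g : ℝ => Z g - HS) =O[𝓝 0] fun g : ℝ => g) →
        (fun g : ℝ => StrongCoupling.contactWork β ρS HS HB (g • V) (X g) (Z g)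
            - StrongCoupling.weakWork β ρS HS)
          =O[𝓝 0] fun g : ℝ => g ^ 2)) := by
  -- From here the initial state is the Gibbs state of the uncoupled Hamiltonian with system part
  -- `HtS`.
  subst hHtρ
  have hVg : ∀ g : ℝ, (g • V).IsHermitian := StrongCoupling.isHermitian_smul hV
  have hΦ := StrongCoupling.isEnergyLoss_right hβ (StrongCoupling.isHermitian_freeHam hHB hHtS)
  have hΨ := StrongCoupling.isEnergyLoss_left hβ (StrongCoupling.isHermitian_freeHam hHB hHS)
  have hF : ∀ (g : ℝ) (X : Matrix S S ℂ), X.IsHermitian →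
      StrongCoupling.deltaFIrr β (StrongCoupling.gibbs β HtS) HB (g • V) X
        = StrongCoupling.gibbsDivergence β (StrongCoupling.freeHam HB HtS)
          (StrongCoupling.freeHam HB HtS + (StrongCoupling.onS B (X - HtS) + g • V)) := by
    intro g X hX
    rw [StrongCoupling.deltaFIrr_eq hβ hHtS hHB (hVg g) hX, StrongCoupling.coupledHam_eq _ _ HtS]
  have hG : ∀ (g : ℝ) (X : Matrix S S ℂ), X.IsHermitian →
      StrongCoupling.deltaFRes β HS HB (g • V) X
        = StrongCoupling.gibbsDivergence β
          (StrongCoupling.freeHam HB HS + (StrongCoupling.onS B (X - HS) + g • V))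
          (StrongCoupling.freeHam HB HS) := by
    intro g X hX
    rw [StrongCoupling.deltaFRes_eq hβ hHS hHB (hVg g) hX, StrongCoupling.coupledHam_eq _ _ HS]
  obtain ⟨hI, hI'⟩ := StrongCoupling.optimal_expansion hβ hHB hHtS hV hΦ hF
  obtain ⟨hR, hR'⟩ := StrongCoupling.optimal_expansion hβ hHB hHS hV hΨ hG
  refine ⟨hI, hR, hI', hR',
    fun g => StrongCoupling.bddAbove_workSet hβ hHtS hHS hHB (hVg g), ?_, ?_⟩
  · obtain ⟨X, hX, -⟩ := hI.1
    obtain ⟨Z, hZ, -⟩ := hR.1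
    -- The error in the maximal work is minus the sum of the errors of the two minimal losses,
    -- wherever both optima exist, hence near `g = 0`.
    refine (hI'.add hR').neg_left.congr' ?_ Filter.EventuallyEq.rfl
    filter_upwards [hX, hZ] with g hXg hZg
    rw [StrongCoupling.maxWork_eq hβ hHtS hHS hHB (hVg g) hXg hZg]
    ring
  · intro X Z hX hZ hXO hZO
    have h1 := StrongCoupling.energyLoss_isBigO hHtS hV hΦ hX hXO
    have h2 := StrongCoupling.energyLoss_isBigO hHS hV hΨ hZ hZO
    refine (h1.add h2).neg_left.congr_left fun g => ?_
    rw [StrongCoupling.contactWork_eq hβ hHtS hHS hHB (hVg g) (hX g) (hZ g), hF g _ (hX g),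
      hG g _ (hZ g)]
    ring
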